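/- Let $\mathbb R^{1+3}$ be Minkowski space with $(x,y)=x_0y_0-x_1y_1-x_2y_2-x_3y_3$, let $\Lambda: SL(2,\mathbb C)\to\mathcal L_+^\uparrow$ be the covering homomorphism onto the proper orthochronous Lorentz group, given by $\widetilde{\Lambda(A)x}=A\,\tilde x\,A^*$ with $\tilde x=x_0\mathbf 1+\sum_{i=1}^3x_i\sigma_i$ ($\sigma_i$ the Pauli matrices), and let $\tilde{\mathcal P}_+^\uparrow=\mathbb R^4\rtimes SL(2,\mathbb C)$ act on $\mathbb R^{1+3}$ by $\Lambda(a,A)x=\Lambda(A)x+a$. *Wedges.* Let $W_1=\{x:|x_0|<x_1\}$. Let $\mathcal W$ be the set of all $\Lambda(g)W_1$ with $g\in\tilde{\mathcal P}_+^\uparrow$, and $\mathcal W_0$ the set of all $\Lambda(A)W_1$ with $A\in SL(2,\mathbb C)$. For $W\in\mathcal W$ let $W'$ be the opposite open wedge, i.e. the interior of $\{x:(x-y,x-y)<0\ \ \forall y\in W\}$. For $W_0\in\mathcal W_0$ let $G_{W_0}\subset\tilde{\mathcal P}_+^\uparrow$ be the subgroup generated by $\{A\in SL(2,\mathbb C):\Lambda(A)W_0=W_0\}$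 and all translations. For $W=\Lambda(g)W_0\in\mathcal W$ with $g\in\tilde{\mathcal P}_+^\uparrow$ and $W_0\in\mathcal W_0$, let $G_W=gG_{W_0}g^{-1}$ (this does not depend on the choice of $g$ and $W_0$). *Scalar representations.* For $m\ge 0$ let $\mathcal H_{m,0}=L^2(\Omega_m,\delta(p^2-m^2)\theta(p_0)\,d^4p)$, where $\Omega_m=\{p:(p,p)=m^2\}$; the measure is the image of $\frac{d^3\mathbf p}{2\sqrt{\mathbf p^2+m^2}}$ under $\mathbf p\mapsto(\sqrt{\mathbf p^2+m^2},\mathbf p)$. On it $\tilde{\mathcal P}_+^\uparrow$ is represented unitarily by $$(U_{m,0}(a,A)\varphi)(p)=e^{i(a,p)}\varphi(\Lambda(A)^{-1}p).$$ The irreducible, unitary, positive-energy scalar representations of $\tilde{\mathcal P}_+^\uparrow$ (massive of spin $0$, or massless of helicity $0$) are those unitarily equivalent to $U_{m,0}$ for some $m\ge 0$. **Proposition.** Let $U$ be an irreducible, unitary, positive-energy scalar representation of $\tilde{\mathcal P}_+^\uparrow$ on a Hilbert space $\mathcal H$. Then $U$ satisfies the modularity condition (MC): for every $W\in\mathcal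 W$ there are $r\in\tilde{\mathcal P}_+^\uparrow$ with $\Lambda(r)W=W'$, and for each such $r$ $$U(r)\in U(G_W)'',$$ where $''$ denotes the double commutant in $B(\mathcal H)$. -/

import Mathlib

namespace Poincare

noncomputable section

open MeasureTheory Matrix
open scoped ENNReal


/-- Minkowski space `ℝ^{1+3}`; the coordinate `0` is time. -/
abbrev Spacetime : Type := Fin 4 → ℝ

/-- The Minkowski form `x₀y₀ - x₁y₁ - x₂y₂ - x₃y₃`. -/
def mink (x y : Spacetime) : ℝ := x 0 * y 0 - x 1 * y 1 - x 2 * y 2 - x 3 * y 3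

/-- The group `SL(2,ℂ)`. -/
abbrev SL2C : Type := Matrix.SpecialLinearGroup (Fin 2) ℂ

/-- `x₀ 1 + x₁ σ₁ + x₂ σ₂ + x₃ σ₃`, with `σᵢ` the Pauli matrices. -/
def herm (x : Spacetime) : Matrix (Fin 2) (Fin 2) ℂ :=
  !![(x 0 : ℂ) + x 3, (x 1 : ℂ) - x 2 * Complex.I;
     (x 1 : ℂ) + x 2 * Complex.I, (x 0 : ℂ) - x 3]

/-- The coordinates of a Hermitian matrix in the basis `1, σ₁, σ₂, σ₃`. -/
def coords (M : Matrix (Fin 2) (Fin 2) ℂ) : Spacetime :=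
  ![((M 0 0).re + (M 1 1).re) / 2, (M 1 0).re, (M 1 0).im, ((M 0 0).re - (M 1 1).re) / 2]

theorem coords_herm (x : Spacetime) : coords (herm x) = x := by
  funext i
  fin_cases i <;> simp [coords, herm]

theorem herm_coords {M : Matrix (Fin 2) (Fin 2) ℂ} (hM : M.IsHermitian) :
    herm (coords M) = M := by
  have h00 := hM.apply 0 0
  have h11 := hM.apply 1 1
  have h01 := hM.apply 0 1
  rw [Complex.ext_iff] at h00 h11 h01
  simp at h00 h11 h01
  ext i j
  fin_cases i <;> fin_cases j <;> apply Complex.ext <;> simp [coords, herm] <;> linarith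

theorem herm_isHermitian (x : Spacetime) : (herm x).IsHermitian := by
  ext i j
  fin_cases i <;> fin_cases j <;> apply Complex.ext <;> simp [herm]

theorem herm_add (x y : Spacetime) : herm (x + y) = herm x + herm y := by
  ext i j
  fin_cases i <;> fin_cases j <;> simp [herm] <;> ring

theorem herm_smul (c : ℝ) (x : Spacetime) : herm (c • x) = (c : ℂ) • herm x := by
  ext i j
  fin_cases i <;> fin_cases j <;> simp [herm] <;> ring

theorem det_herm (x : Spacetime) : (herm x).det = (mink x x : ℂ) := by
  simp only [herm, Matrix.det_fin_two_of, mink]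
  push_cast
  linear_combination ((x 2 : ℂ) ^ 2) * Complex.I_sq

/-- The Lorentz transformation covered by `A`: it sends `x` to the vector `y` with
`herm y = A (herm x) A*`. -/
def lorentzAct (A : SL2C) (x : Spacetime) : Spacetime :=
  coords (A.1 * herm x * A.1ᴴ)

theorem herm_lorentzAct (A : SL2C) (x : Spacetime) :
    herm (lorentzAct A x) =
      A.1 * herm x * A.1ᴴ :=
  herm_coords (isHermitian_mul_mul_conjTranspose _ (herm_isHermitian x))

theorem herm_injective : Function.Injective herm :=
  Function.LeftInverse.injective coords_herm

theorem lorentzAct_mul (A B : SL2C) (x : Spacetime) :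
    lorentzAct (A * B) x = lorentzAct A (lorentzAct B x) := by
  apply herm_injective
  have h : (A * B).1 = A.1 * B.1 := rfl
  simp only [herm_lorentzAct, h, conjTranspose_mul, Matrix.mul_assoc]

theorem lorentzAct_one (x : Spacetime) : lorentzAct 1 x = x := by
  apply herm_injective
  simp [herm_lorentzAct]

/-- The covering homomorphism `Λ : SL(2,ℂ) → 𝓛₊↑`, as linear automorphisms of spacetime. -/
def lorentz : SL2C →* (Spacetime ≃ₗ[ℝ] Spacetime) where
  toFun A :=
    { toFun := lorentzAct A
      invFun := lorentzAct A⁻¹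
      left_inv := fun x => by rw [← lorentzAct_mul, inv_mul_cancel, lorentzAct_one]
      right_inv := fun x => by rw [← lorentzAct_mul, mul_inv_cancel, lorentzAct_one]
      map_add' := fun x y => by
        apply herm_injective
        simp only [herm_lorentzAct, herm_add, Matrix.mul_add, Matrix.add_mul]
      map_smul' := fun c x => by
        apply herm_injective
        simp only [herm_lorentzAct, herm_smul, Matrix.mul_smul, Matrix.smul_mul,
          RingHom.id_apply] }
  map_one' := by
    ext1 x
    exact lorentzAct_one x
  map_mul' A B := by
    ext1 x
    exact lorentzAct_mul A B x

theorem herm_lorentz (A : SL2C) (x : Spacetime) :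
    herm (lorentz A x) =
      A.1 * herm x * A.1ᴴ :=
  herm_lorentzAct A x

theorem mink_lorentz_self (A : SL2C) (x : Spacetime) :
    mink (lorentz A x) (lorentz A x) = mink x x := by
  have h : (herm (lorentz A x)).det = (herm x).det := by
    rw [herm_lorentz, det_mul, det_mul, det_conjTranspose, A.2]
    simp
  rw [det_herm, det_herm] at h
  exact_mod_cast h

theorem mink_lorentz (A : SL2C) (x y : Spacetime) :
    mink (lorentz A x) (lorentz A y) = mink x y := by
  have h1 := mink_lorentz_self A (x + y)
  have h2 := mink_lorentz_self A x
  have h3 := mink_lorentz_self A y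
  rw [map_add] at h1
  simp only [mink, Pi.add_apply] at *
  linarith

theorem lorentz_inv_apply (A : SL2C) (x : Spacetime) : lorentz A⁻¹ (lorentz A x) = x := by
  rw [← LinearEquiv.mul_apply, ← map_mul, inv_mul_cancel, map_one]; rfl

theorem lorentz_apply_inv (A : SL2C) (x : Spacetime) : lorentz A (lorentz A⁻¹ x) = x := by
  rw [← LinearEquiv.mul_apply, ← map_mul, mul_inv_cancel, map_one]; rfl

theorem mink_lorentz_left (A : SL2C) (x y : Spacetime) :
    mink (lorentz A x) y = mink x (lorentz A⁻¹ y) := by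
  rw [← mink_lorentz A x (lorentz A⁻¹ y), lorentz_apply_inv]

/-- Positivity of the Hermitian form of a timelike future vector, in coordinates. -/
theorem form_nonneg {x : Spacetime} (h0 : 0 < x 0) (hx : 0 < mink x x) (a1 a2 b1 b2 : ℝ) :
    0 ≤ (x 0 + x 3) * (a1 ^ 2 + a2 ^ 2) + (x 0 - x 3) * (b1 ^ 2 + b2 ^ 2)
      + 2 * (x 1 * (a1 * b1 + a2 * b2) + x 2 * (a2 * b1 * (-1) + a1 * b2) * (-1)) := by
  simp only [mink] at hx
  have hp : 0 < x 0 + x 3 := by nlinarith [sq_nonneg (x 1), sq_nonneg (x 2)]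
  have key : 0 ≤ (x 0 + x 3) * ((x 0 + x 3) * (a1 ^ 2 + a2 ^ 2) + (x 0 - x 3) * (b1 ^ 2 + b2 ^ 2)
      + 2 * (x 1 * (a1 * b1 + a2 * b2) + x 2 * (a2 * b1 * (-1) + a1 * b2) * (-1))) := by
    have : 0 ≤ ((x 0 + x 3) * a1 + x 1 * b1 - x 2 * b2) ^ 2
      + ((x 0 + x 3) * a2 + x 1 * b2 + x 2 * b1) ^ 2
      + (x 0 * x 0 - x 1 * x 1 - x 2 * x 2 - x 3 * x 3) * (b1 ^ 2 + b2 ^ 2) := by positivity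
    nlinarith [this]
  exact nonneg_of_mul_nonneg_right key hp

theorem lorentz_time_pos (A : SL2C) {x : Spacetime} (h0 : 0 < x 0) (hx : 0 < mink x x) :
    0 < lorentz A x 0 := by
  have hne : lorentz A x 0 ≠ 0 := by
    intro h
    have := mink_lorentz_self A x
    simp only [mink, h] at this hx
    nlinarith [sq_nonneg (lorentz A x 1), sq_nonneg (lorentz A x 2), sq_nonneg (lorentz A x 3)]
  refine lt_of_le_of_ne ?_ hne.symm
  have e : lorentz A x 0 = coords (A.1 * herm x *
    A.1ᴴ) 0 := rfl
  rw [e]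
  have f1 := form_nonneg h0 hx (A 0 0).re (A 0 0).im (A 0 1).re (A 0 1).im
  have f2 := form_nonneg h0 hx (A 1 0).re (A 1 0).im (A 1 1).re (A 1 1).im
  simp [coords, herm, Matrix.mul_apply, Fin.sum_univ_two]
  nlinarith [f1, f2]

theorem lorentz_time_pos_iff (A : SL2C) {x : Spacetime} (hx : 0 < mink x x) :
    0 < lorentz A x 0 ↔ 0 < x 0 := by
  refine ⟨fun h => ?_, fun h => lorentz_time_pos A h hx⟩
  have := lorentz_time_pos A⁻¹ h (by rwa [mink_lorentz_self])
  rwa [lorentz_inv_apply] at this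

theorem abs_det_lorentz (A : SL2C) :
    |LinearMap.det (lorentz A : Spacetime →ₗ[ℝ] Spacetime)| = 1 := by
  set M := LinearMap.toMatrix' (lorentz A : Spacetime →ₗ[ℝ] Spacetime) with hM
  set η : Matrix (Fin 4) (Fin 4) ℝ := Matrix.diagonal ![1, -1, -1, -1] with hη
  have hm : ∀ x y, mink x y = x ⬝ᵥ η *ᵥ y := by
    intro x y
    simp [hη, mink, dotProduct, Matrix.mulVec_diagonal, Fin.sum_univ_four]
    ring
  have hMx : ∀ x, M *ᵥ x = lorentz A x := fun x => LinearMap.toMatrix'_mulVec _ _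
  have h : Mᵀ * η * M = η := by
    ext i j
    have := mink_lorentz A (Pi.single i 1) (Pi.single j 1)
    rw [hm, hm, ← hMx, ← hMx, Matrix.dotProduct_mulVec, Matrix.vecMul_mulVec] at this
    rw [← Matrix.dotProduct_mulVec] at this
    rw [Matrix.mulVec_mulVec, Matrix.mulVec_single_one, Matrix.mulVec_single_one,
      single_one_dotProduct, single_one_dotProduct] at this
    exact this
  have hd : M.det * M.det = 1 := by
    have h2 := congrArg Matrix.det h
    rw [det_mul, det_mul, det_transpose] at h2
    have h3 : η.det = -1 := by simp [hη, Fin.prod_univ_four]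
    rw [h3] at h2
    linarith
  rw [← LinearMap.det_toMatrix', ← hM]
  rcases mul_self_eq_one_iff.1 hd with h | h <;> simp [h]


/-- The relativistic energy `√(q² + m²)` of a particle of mass `m` and momentum `q`. -/
def energy (m : ℝ) (q : Fin 3 → ℝ) : ℝ := √(q 0 ^ 2 + q 1 ^ 2 + q 2 ^ 2 + m ^ 2)

/-- The point `(√(q² + m²), q)` of the mass shell. -/
def shellPoint (m : ℝ) (q : Fin 3 → ℝ) : Spacetime := Matrix.vecCons (energy m q) q

/-- The measure `δ(p² - m²) θ(p₀) d⁴p` on the mass shell, as a measure on momentum space: the image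
of `d³q / (2 √(q² + m²))` under `q ↦ (√(q² + m²), q)`. -/
def massShell (m : ℝ) : Measure Spacetime :=
  ((volume : Measure (Fin 3 → ℝ)).withDensity
    (fun q => ENNReal.ofReal (1 / (2 * energy m q)))).map (shellPoint m)

theorem continuous_energy_uncurried :
    Continuous (fun x : ℝ × (Fin 3 → ℝ) => energy x.1 x.2) := by
  unfold energy; fun_prop

theorem continuous_energy (m : ℝ) : Continuous (energy m) := by
  unfold energy; fun_prop

theorem continuous_shellPoint_uncurried :
    Continuous (fun x : ℝ × (Fin 3 → ℝ) => shellPoint x.1 x.2) :=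
  continuous_energy_uncurried.matrixVecCons continuous_snd

theorem continuous_shellPoint (m : ℝ) : Continuous (shellPoint m) :=
  (continuous_energy m).matrixVecCons continuous_id

theorem lintegral_massShell (m : ℝ) {f : Spacetime → ℝ≥0∞} (hf : Measurable f) :
    ∫⁻ p, f p ∂massShell m =
      ∫⁻ q : Fin 3 → ℝ, ENNReal.ofReal (1 / (2 * energy m q)) * f (shellPoint m q) := by
  have hE := (continuous_energy m).measurable
  have hfs : Measurable (fun q => f (shellPoint m q)) :=
    hf.comp (continuous_shellPoint m).measurable
  rw [massShell, lintegral_map hf (continuous_shellPoint m).measurable,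
    lintegral_withDensity_eq_lintegral_mul _ (by fun_prop) hfs]
  rfl

/-- The open forward light cone. -/
def fwdCone : Set Spacetime := {p | 0 < p 0 ∧ 0 < mink p p}

theorem energy_pos {m : ℝ} (hm : 0 < m) (q : Fin 3 → ℝ) : 0 < energy m q := by
  unfold energy; positivity

theorem energy_sq (m : ℝ) (q : Fin 3 → ℝ) :
    energy m q ^ 2 = q 0 ^ 2 + q 1 ^ 2 + q 2 ^ 2 + m ^ 2 := by
  unfold energy; exact Real.sq_sqrt (by positivity)

theorem mink_shellPoint (m : ℝ) (q : Fin 3 → ℝ) :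
    mink (shellPoint m q) (shellPoint m q) = m ^ 2 := by
  have h := energy_sq m q
  have h0 : shellPoint m q 0 = energy m q := rfl
  have h1 : shellPoint m q 1 = q 0 := rfl
  have h2 : shellPoint m q 2 = q 1 := rfl
  have h3 : shellPoint m q 3 = q 2 := rfl
  simp only [mink, h0, h1, h2, h3]
  linarith

theorem lintegral_slice (q : Fin 3 → ℝ) (f : Spacetime → ℝ≥0∞) :
    ∫⁻ t : ℝ, fwdCone.indicator f (vecCons t q) =
      ∫⁻ m in Set.Ioi (0 : ℝ), ENNReal.ofReal (m / energy m q) * f (shellPoint m q) := by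
  set E : ℝ := √(q 0 ^ 2 + q 1 ^ 2 + q 2 ^ 2) with hE
  have hE2 : E ^ 2 = q 0 ^ 2 + q 1 ^ 2 + q 2 ^ 2 := Real.sq_sqrt (by positivity)
  have hE0 : 0 ≤ E := Real.sqrt_nonneg _
  have hcone : ∀ t : ℝ, vecCons t q ∈ fwdCone ↔ t ∈ Set.Ioi E := by
    intro t
    have : mink (vecCons t q) (vecCons t q) = t ^ 2 - E ^ 2 := by
      have h0 : (vecCons t q : Spacetime) 0 = t := rfl
      have h1 : (vecCons t q : Spacetime) 1 = q 0 := rfl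
      have h2 : (vecCons t q : Spacetime) 2 = q 1 := rfl
      have h3 : (vecCons t q : Spacetime) 3 = q 2 := rfl
      simp only [mink, h0, h1, h2, h3, hE2]; ring
    have h0 : (vecCons t q : Spacetime) 0 = t := rfl
    simp only [fwdCone, Set.mem_ofPred_eq, this, Set.mem_Ioi, h0]
    constructor
    · rintro ⟨h1, h2⟩; nlinarith
    · intro h; exact ⟨by linarith, by nlinarith⟩
  have himg : (fun m => energy m q) '' Set.Ioi 0 = Set.Ioi E := by
    ext t
    constructor
    · rintro ⟨m, hm, rfl⟩
      have hm : 0 < m := hm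
      exact Real.sqrt_lt_sqrt (by positivity) (by nlinarith)
    · intro h
      have h : E < t := h
      refine ⟨√(t ^ 2 - E ^ 2), Real.sqrt_pos.2 (by nlinarith), ?_⟩
      simp only [energy]
      rw [Real.sq_sqrt (by nlinarith), ← hE2]
      rw [show E ^ 2 + (t ^ 2 - E ^ 2) = t ^ 2 by ring, Real.sqrt_sq (by linarith)]
  have hinj : Set.InjOn (fun m => energy m q) (Set.Ioi 0) := by
    intro a ha b hb h
    have ha : 0 < a := ha
    have hb : 0 < b := hb
    have h' : energy a q ^ 2 = energy b q ^ 2 := by rw [show energy a q = energy b q from h]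
    rw [energy_sq, energy_sq] at h'
    nlinarith
  have hder : ∀ m ∈ Set.Ioi (0:ℝ),
      HasDerivWithinAt (fun m => energy m q) (m / energy m q) (Set.Ioi 0) m := by
    intro m hm
    have hm : 0 < m := hm
    have h1 : HasDerivAt (fun m : ℝ => q 0 ^ 2 + q 1 ^ 2 + q 2 ^ 2 + m ^ 2) (2 * m) m := by
      simpa using ((hasDerivAt_pow 2 m).const_add (q 0 ^ 2 + q 1 ^ 2 + q 2 ^ 2))
    have h2 := h1.sqrt (by positivity)
    have h3 : 2 * m / (2 * √(q 0 ^ 2 + q 1 ^ 2 + q 2 ^ 2 + m ^ 2)) = m / energy m q := by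
      unfold energy; rw [mul_div_mul_left _ _ two_ne_zero]
    rw [h3] at h2
    exact h2.hasDerivWithinAt
  have h := lintegral_image_eq_lintegral_abs_deriv_mul measurableSet_Ioi hder hinj
    (fun t => f (vecCons t q))
  rw [himg] at h
  have h1 : ∫⁻ t : ℝ, fwdCone.indicator f (vecCons t q) =
      ∫⁻ t in Set.Ioi E, f (vecCons t q) := by
    rw [← lintegral_indicator measurableSet_Ioi]
    congr 1
    funext t
    by_cases ht : t ∈ Set.Ioi E
    · rw [Set.indicator_of_mem ht, Set.indicator_of_mem ((hcone t).2 ht)]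
    · rw [Set.indicator_of_notMem ht, Set.indicator_of_notMem (fun h => ht ((hcone t).1 h))]
  rw [h1, h]
  refine setLIntegral_congr_fun measurableSet_Ioi fun m hm => ?_
  have hm : 0 < m := hm
  rw [abs_of_pos (div_pos hm (energy_pos hm q))]
  rfl

theorem measurable_mink_self : Measurable (fun p : Spacetime => mink p p) := by
  unfold mink; fun_prop

theorem measurableSet_fwdCone : MeasurableSet fwdCone :=
  (measurableSet_lt measurable_const (measurable_pi_apply 0)).inter
    (measurableSet_lt measurable_const measurable_mink_self)

/-- Lebesgue measure on the forward cone is an integral over the masses. -/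
theorem lintegral_fwdCone {f : Spacetime → ℝ≥0∞} (hf : Measurable f) :
    ∫⁻ p in fwdCone, f p =
      ∫⁻ m in Set.Ioi (0 : ℝ), ENNReal.ofReal (2 * m) * ∫⁻ p, f p ∂massShell m := by
  have hcf : Measurable (fwdCone.indicator f) := hf.indicator measurableSet_fwdCone
  have hv : Measurable (fun x : ℝ × (Fin 3 → ℝ) => (vecCons x.1 x.2 : Spacetime)) :=
    (continuous_fst.matrixVecCons continuous_snd).measurable
  rw [← lintegral_indicator measurableSet_fwdCone,
    ← (volume_preserving_piFinSuccAbove (fun _ : Fin 4 => ℝ) 0).symm.lintegral_comp hcf]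
  have e : ∀ x : ℝ × (Fin 3 → ℝ),
      (MeasurableEquiv.piFinSuccAbove (fun _ : Fin 4 => ℝ) 0).symm x = vecCons x.1 x.2 := by
    intro x
    simp [MeasurableEquiv.piFinSuccAbove, Fin.insertNthEquiv, vecCons]
  simp_rw [e]
  have hcv : Measurable (fun x : ℝ × (Fin 3 → ℝ) => fwdCone.indicator f (vecCons x.1 x.2)) :=
    hcf.comp hv
  rw [Measure.volume_eq_prod, lintegral_prod_symm' _ hcv]
  simp_rw [lintegral_slice]
  have hsh := continuous_shellPoint_uncurried.measurable
  have hen := continuous_energy_uncurried.measurable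
  have hM : Measurable (fun x : ℝ × (Fin 3 → ℝ) =>
      ENNReal.ofReal (x.1 / energy x.1 x.2) * f (shellPoint x.1 x.2)) := by
    exact ((measurable_fst.div hen).ennreal_ofReal).mul (hf.comp hsh)
  have hM' : Measurable (Function.uncurry fun (q : Fin 3 → ℝ) (m : ℝ) =>
      ENNReal.ofReal (m / energy m q) * f (shellPoint m q)) := hM.comp measurable_swap
  rw [lintegral_lintegral_swap hM'.aemeasurable]
  refine setLIntegral_congr_fun measurableSet_Ioi fun m hm => ?_
  have hm : 0 < m := hm
  rw [lintegral_massShell m hf, ← lintegral_const_mul']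
  · congr 1
    funext q
    rw [← mul_assoc, ← ENNReal.ofReal_mul (by positivity)]
    congr 2
    have := (energy_pos hm q).ne'
    field_simp
  · exact ENNReal.ofReal_ne_top


theorem norm_le_energy (m : ℝ) (q : Fin 3 → ℝ) : ‖q‖ ≤ energy m q := by
  refine (pi_norm_le_iff_of_nonneg (Real.sqrt_nonneg _)).2 fun i => ?_
  rw [Real.norm_eq_abs]
  refine Real.abs_le_sqrt ?_
  fin_cases i <;> simp <;> nlinarith [sq_nonneg (q 0), sq_nonneg (q 1), sq_nonneg (q 2), sq_nonneg m]

theorem norm_le_norm_shellPoint (m : ℝ) (q : Fin 3 → ℝ) : ‖q‖ ≤ ‖shellPoint m q‖ :=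
  (pi_norm_le_iff_of_nonneg (norm_nonneg _)).2 fun i => norm_le_pi_norm (shellPoint m q) i.succ

/-- `1/‖q‖` is integrable near the origin of `ℝ³`. -/
theorem integrable_bound (R : ℝ) :
    Integrable (fun q : Fin 3 → ℝ => (Set.Iic R).indicator (fun r : ℝ => r⁻¹) ‖q‖) := by
  have h := (integrable_fun_norm_addHaar (E := Fin 3 → ℝ) volume
    (f := (Set.Iic R).indicator (fun r : ℝ => r⁻¹)))
  rw [h]
  have : Module.finrank ℝ (Fin 3 → ℝ) - 1 = 2 := by simp
  rw [this]
  have h2 : IntegrableOn ((Set.Iic R).indicator (fun r : ℝ => r)) (Set.Ioi 0) := by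
    rw [IntegrableOn, integrable_indicator_iff measurableSet_Iic, IntegrableOn,
      Measure.restrict_restrict measurableSet_Iic, Set.inter_comm, Set.Ioi_inter_Iic]
    exact (continuous_id.integrableOn_Icc).mono_set Set.Ioc_subset_Icc_self
  refine h2.congr_fun (fun r hr => ?_) measurableSet_Ioi
  have hr : r ≠ 0 := ne_of_gt hr
  by_cases hR : r ∈ Set.Iic R
  · simp only [Set.indicator_of_mem hR, smul_eq_mul]
    field_simp
  · simp [Set.indicator_of_notMem hR]

theorem ae_ne_zero : ∀ᵐ q : Fin 3 → ℝ, q ≠ 0 := by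
  rw [ae_iff]; simp

theorem ae_density_le (R : ℝ) : ∀ᵐ q : Fin 3 → ℝ, ∀ m : ℝ, ‖q‖ ≤ R →
    1 / (2 * energy m q) ≤ (Set.Iic R).indicator (fun r : ℝ => r⁻¹) ‖q‖ := by
  filter_upwards [ae_ne_zero] with q hq m hR
  rw [Set.indicator_of_mem (show ‖q‖ ∈ Set.Iic R from hR)]
  have := norm_pos_iff.2 hq
  have h2 := norm_le_energy m q
  rw [one_div]
  exact inv_anti₀ this (by linarith)

theorem density_nonneg (m : ℝ) (q : Fin 3 → ℝ) : 0 ≤ 1 / (2 * energy m q) := by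
  have : 0 ≤ energy m q := Real.sqrt_nonneg _
  positivity

instance (m : ℝ) : IsFiniteMeasureOnCompacts (massShell m) where
  lt_top_of_isCompact := by
    intro K hK
    obtain ⟨R, hR⟩ := hK.isBounded.exists_norm_le
    rw [← lintegral_indicator_one hK.measurableSet,
      lintegral_massShell m (measurable_one.indicator hK.measurableSet)]
    refine lt_of_le_of_lt ?_ (integrable_bound R).lintegral_lt_top
    refine lintegral_mono_ae ?_
    filter_upwards [ae_density_le R] with q hq
    by_cases h : shellPoint m q ∈ K
    · rw [Set.indicator_of_mem h, Pi.one_apply, mul_one]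
      exact ENNReal.ofReal_le_ofReal (hq m ((norm_le_norm_shellPoint m q).trans (hR _ h)))
    · rw [Set.indicator_of_notMem h, mul_zero]
      exact zero_le

theorem continuous_massShell_integral {h : Spacetime → ℝ} (hc : Continuous h)
    (hs : HasCompactSupport h) :
    Continuous fun m : ℝ =>
      ∫ q : Fin 3 → ℝ, 1 / (2 * energy m q) * h (shellPoint m q) := by
  obtain ⟨C, hC⟩ := hs.exists_bound_of_continuous hc
  obtain ⟨R, hR⟩ := hs.isCompact.isBounded.exists_norm_le
  have hC0 : 0 ≤ C := (norm_nonneg _).trans (hC 0)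
  have hbn : ∀ q : Fin 3 → ℝ, 0 ≤ (Set.Iic R).indicator (fun r : ℝ => r⁻¹) ‖q‖ := fun q =>
    Set.indicator_apply_nonneg fun _ => inv_nonneg.2 (norm_nonneg q)
  refine continuous_of_dominated
    (bound := fun q => (Set.Iic R).indicator (fun r : ℝ => r⁻¹) ‖q‖ * C) ?_ ?_ ?_ ?_
  · intro m
    have h1 := (continuous_energy m).measurable
    have h2 := (hc.comp (continuous_shellPoint m)).measurable
    exact ((measurable_const.div (h1.const_mul 2)).mul h2).aestronglyMeasurable
  · intro m
    filter_upwards [ae_density_le R] with q hq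
    rw [norm_mul, Real.norm_of_nonneg (density_nonneg m q)]
    by_cases hz : h (shellPoint m q) = 0
    · rw [hz, norm_zero, mul_zero]
      exact mul_nonneg (hbn q) hC0
    · have := hR _ (subset_tsupport h hz)
      exact mul_le_mul (hq m ((norm_le_norm_shellPoint m q).trans this)) (hC _) (norm_nonneg _)
        (hbn q)
  · exact (integrable_bound R).mul_const C
  · filter_upwards [ae_ne_zero] with q hq
    have h1 : Continuous fun m => energy m q :=
      continuous_energy_uncurried.comp (continuous_id.prodMk continuous_const)
    have h2 : Continuous fun m => shellPoint m q :=
      continuous_shellPoint_uncurried.comp (continuous_id.prodMk continuous_const)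
    have h3 : ∀ m, 2 * energy m q ≠ 0 := fun m => by
      have := (norm_pos_iff.2 hq).trans_le (norm_le_energy m q)
      positivity
    exact (continuous_const.div (continuous_const.mul h1) h3).mul (hc.comp h2)

theorem continuous_lorentz (A : SL2C) : Continuous (lorentz A) :=
  (lorentz A : Spacetime →ₗ[ℝ] Spacetime).continuous_of_finiteDimensional

theorem lintegral_eq_ofReal {h : Spacetime → ℝ} (hc : Continuous h)
    (hs : HasCompactSupport h) (h0 : ∀ p, 0 ≤ h p) (m : ℝ) :
    ∫⁻ p, ENNReal.ofReal (h p) ∂massShell m =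
      ENNReal.ofReal (∫ q : Fin 3 → ℝ, 1 / (2 * energy m q) * h (shellPoint m q)) := by
  have h1 := (continuous_energy m).measurable
  have h2 := (hc.comp (continuous_shellPoint m)).measurable
  have hi : ∫⁻ p, ENNReal.ofReal (h p) ∂massShell m =
      ∫⁻ q : Fin 3 → ℝ, ENNReal.ofReal (1 / (2 * energy m q) * h (shellPoint m q)) := by
    rw [lintegral_massShell m hc.measurable.ennreal_ofReal]
    congr 1
    funext q
    rw [ENNReal.ofReal_mul (density_nonneg m q)]
  have hn : ∀ q, 0 ≤ 1 / (2 * energy m q) * h (shellPoint m q) := fun q =>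
    mul_nonneg (density_nonneg m q) (h0 _)
  rw [hi, ofReal_integral_eq_lintegral_ofReal _ (Filter.Eventually.of_forall hn)]
  refine ⟨((measurable_const.div (h1.const_mul 2)).mul h2).aestronglyMeasurable, ?_⟩
  rw [hasFiniteIntegral_iff_ofReal (Filter.Eventually.of_forall hn), ← hi]
  exact (hc.integrable_of_hasCompactSupport hs).lintegral_lt_top

theorem measurePreserving_lorentz_volume (A : SL2C) :
    MeasurePreserving (lorentz A) (volume : Measure Spacetime) volume := by
  refine ⟨(continuous_lorentz A).measurable, ?_⟩
  have hd := abs_det_lorentz A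
  have hne : LinearMap.det (lorentz A : Spacetime →ₗ[ℝ] Spacetime) ≠ 0 := by
    intro h; simp [h] at hd
  have := Measure.map_linearMap_addHaar_eq_smul_addHaar (volume : Measure Spacetime) hne
  rw [abs_inv, hd] at this
  simpa using this

theorem lintegral_fwdCone_lorentz (A : SL2C) {f : Spacetime → ℝ≥0∞} (hf : Measurable f) :
    ∫⁻ p in fwdCone, f (lorentz A p) = ∫⁻ p in fwdCone, f p := by
  rw [← lintegral_indicator measurableSet_fwdCone, ← lintegral_indicator measurableSet_fwdCone,
    ← (measurePreserving_lorentz_volume A).lintegral_comp (hf.indicator measurableSet_fwdCone)]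
  congr 1
  funext p
  have : lorentz A p ∈ fwdCone ↔ p ∈ fwdCone := by
    simp only [fwdCone, Set.mem_ofPred_eq, mink_lorentz_self]
    exact ⟨fun h => ⟨(lorentz_time_pos_iff A h.2).1 h.1, h.2⟩,
      fun h => ⟨(lorentz_time_pos_iff A h.2).2 h.1, h.2⟩⟩
  by_cases hp : p ∈ fwdCone
  · rw [Set.indicator_of_mem hp, Set.indicator_of_mem (this.2 hp)]
  · rw [Set.indicator_of_notMem hp, Set.indicator_of_notMem (fun h => hp (this.1 h))]

/-- Integrating over the mass shells with masses in `S`. -/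
theorem lintegral_masses {h : Spacetime → ℝ≥0∞} (hh : Measurable h) {S : Set ℝ}
    (hS : MeasurableSet S) :
    ∫⁻ p in fwdCone, S.indicator 1 (√(mink p p)) * h p =
      ∫⁻ m in S, ENNReal.ofReal (2 * m) * ∫⁻ p, h p ∂massShell m
        ∂(volume.restrict (Set.Ioi (0 : ℝ))) := by
  have hm : Measurable fun p : Spacetime => S.indicator (1 : ℝ → ℝ≥0∞) (√(mink p p)) :=
    (measurable_one.indicator hS).comp measurable_mink_self.sqrt
  have hmh : Measurable fun p : Spacetime => S.indicator (1 : ℝ → ℝ≥0∞) (√(mink p p)) * h p :=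
    hm.mul hh
  rw [lintegral_fwdCone hmh, ← lintegral_indicator hS]
  refine setLIntegral_congr_fun measurableSet_Ioi fun m hm0 => ?_
  have hm0 : 0 < m := hm0
  rw [lintegral_massShell m hmh]
  simp only [mink_shellPoint, Real.sqrt_sq hm0.le]
  by_cases hmS : m ∈ S
  · simp only [Set.indicator_of_mem hmS, Pi.one_apply, one_mul]
    rw [lintegral_massShell m hh]
  · simp [Set.indicator_of_notMem hmS]

theorem lintegral_massShell_lorentz (A : SL2C) {h : Spacetime → ℝ} (hc : Continuous h)
    (hs : HasCompactSupport h) (h0 : ∀ p, 0 ≤ h p) (m : ℝ) :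
    ∫⁻ p, ENNReal.ofReal (h (lorentz A p)) ∂massShell m =
      ∫⁻ p, ENNReal.ofReal (h p) ∂massShell m := by
  have hc' : Continuous fun p => h (lorentz A p) := hc.comp (continuous_lorentz A)
  have hs' : HasCompactSupport fun p => h (lorentz A p) :=
    hs.comp_homeomorph (lorentz A).toContinuousLinearEquiv.toHomeomorph
  have h0' : ∀ p, 0 ≤ h (lorentz A p) := fun p => h0 _
  set F : ℝ → ℝ := fun m => ∫ q : Fin 3 → ℝ, 1 / (2 * energy m q) * h (shellPoint m q) with hF
  set G : ℝ → ℝ := fun m =>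
    ∫ q : Fin 3 → ℝ, 1 / (2 * energy m q) * h (lorentz A (shellPoint m q)) with hG
  have hFc : Continuous F := continuous_massShell_integral hc hs
  have hGc : Continuous G := continuous_massShell_integral hc' hs'
  have hF0 : ∀ m, 0 ≤ F m := fun m =>
    integral_nonneg fun q => mul_nonneg (density_nonneg m q) (h0 _)
  have hG0 : ∀ m, 0 ≤ G m := fun m =>
    integral_nonneg fun q => mul_nonneg (density_nonneg m q) (h0 _)
  have hFl : ∀ m, ∫⁻ p, ENNReal.ofReal (h p) ∂massShell m = ENNReal.ofReal (F m) :=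
    lintegral_eq_ofReal hc hs h0
  have hGl : ∀ m, ∫⁻ p, ENNReal.ofReal (h (lorentz A p)) ∂massShell m = ENNReal.ofReal (G m) :=
    lintegral_eq_ofReal hc' hs' h0'
  have hae : (fun m => ENNReal.ofReal (2 * m) * ENNReal.ofReal (G m)) =ᵐ[volume.restrict
      (Set.Ioi (0 : ℝ))] fun m => ENNReal.ofReal (2 * m) * ENNReal.ofReal (F m) := by
    refine ae_eq_of_forall_setLIntegral_eq_of_sigmaFinite (by fun_prop) (by fun_prop)
      fun S hS _ => ?_
    simp_rw [← hFl, ← hGl]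
    have hfm : Measurable fun p : Spacetime =>
        S.indicator (1 : ℝ → ℝ≥0∞) (√(mink p p)) * ENNReal.ofReal (h p) :=
      ((measurable_one.indicator hS).comp measurable_mink_self.sqrt).mul
        hc.measurable.ennreal_ofReal
    rw [← lintegral_masses hc'.measurable.ennreal_ofReal hS,
      ← lintegral_masses hc.measurable.ennreal_ofReal hS,
      ← lintegral_fwdCone_lorentz A hfm]
    simp only [mink_lorentz_self]
  have hae2 : G =ᵐ[volume.restrict (Set.Ici (0 : ℝ))] F := by
    rw [Filter.EventuallyEq, ← Measure.restrict_congr_set Ioi_ae_eq_Ici]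
    filter_upwards [hae, ae_restrict_mem measurableSet_Ioi] with m hm hm0
    have hm0 : 0 < m := hm0
    rw [← ENNReal.ofReal_mul (by positivity), ← ENNReal.ofReal_mul (by positivity),
      ENNReal.ofReal_eq_ofReal_iff (mul_nonneg (by positivity) (hG0 m))
        (mul_nonneg (by positivity) (hF0 m))] at hm
    exact mul_left_cancel₀ (by positivity) hm
  have heq : Set.EqOn G F (Set.Ici 0) :=
    Measure.eqOn_of_ae_eq hae2 hGc.continuousOn hFc.continuousOn (by simp)
  have habs : ∀ q, energy |m| q = energy m q := fun q => by simp [energy]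
  have hsp : ∀ q, shellPoint |m| q = shellPoint m q := fun q => by simp [shellPoint, habs]
  have hm := heq (show |m| ∈ Set.Ici (0 : ℝ) from abs_nonneg m)
  simp only [hF, hG, habs, hsp] at hm
  rw [hFl, hGl]
  simp only [hF, hG, hm]

instance (A : SL2C) (m : ℝ) : IsFiniteMeasureOnCompacts ((massShell m).map (lorentz A)) :=
  MeasureTheory.Measure.IsFiniteMeasureOnCompacts.map _ (lorentz A).toContinuousLinearEquiv.toHomeomorph

/-- The measure on the mass shell is Lorentz invariant. -/
theorem measurePreserving_lorentz (A : SL2C) (m : ℝ) :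
    MeasurePreserving (lorentz A) (massShell m) (massShell m) := by
  refine ⟨(continuous_lorentz A).measurable, ?_⟩
  refine Measure.ext_of_integral_eq_on_compactlySupported_nnreal fun f => ?_
  have hc : Continuous fun p => (f p : ℝ) := by fun_prop
  have hs : HasCompactSupport fun p => (f p : ℝ) :=
    f.hasCompactSupport.comp_left (g := fun x : NNReal => (x : ℝ)) rfl
  rw [integral_map (continuous_lorentz A).aemeasurable hc.aestronglyMeasurable,
    integral_eq_lintegral_of_nonneg_ae, integral_eq_lintegral_of_nonneg_ae,
    lintegral_massShell_lorentz A hc hs (fun p => (f p).2)]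
  · exact Filter.Eventually.of_forall fun p => (f p).2
  · exact hc.aestronglyMeasurable
  · exact Filter.Eventually.of_forall fun p => (f _).2
  · exact (hc.comp (continuous_lorentz A)).aestronglyMeasurable


/-- The action of `SL(2,ℂ)` on the translation group by Lorentz transformations. -/
def lorentzAut : SL2C →* MulAut (Multiplicative Spacetime) where
  toFun A := AddEquiv.toMultiplicative (lorentz A).toAddEquiv
  map_one' := by
    ext x : 1
    exact congrArg Multiplicative.ofAdd (lorentzAct_one x.toAdd)
  map_mul' A B := by
    ext x : 1
    exact congrArg Multiplicative.ofAdd (lorentzAct_mul A B x.toAdd)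

/-- The universal covering `ℝ⁴ ⋊ SL(2,ℂ)` of the proper orthochronous Poincaré group. -/
abbrev PoincareCover : Type := Multiplicative Spacetime ⋊[lorentzAut] SL2C

/-- The action of the covering group on spacetime: `(a, A)` acts by `x ↦ Λ(A) x + a`. -/
def act (g : PoincareCover) (x : Spacetime) : Spacetime :=
  lorentz g.right x + g.left.toAdd

theorem act_one (x : Spacetime) : act 1 x = x := by
  simp [act]

theorem act_mul (g h : PoincareCover) (x : Spacetime) : act (g * h) x = act g (act h x) := by
  have e : (g * h).left.toAdd = g.left.toAdd + lorentz g.right h.left.toAdd := rfl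
  simp only [act, e, SemidirectProduct.mul_right, map_mul, LinearEquiv.mul_apply, map_add]
  abel

/-- The Hilbert space `L²(Ω_m, δ(p² - m²) θ(p₀) d⁴p)`. -/
abbrev ShellSpace (m : ℝ) : Type := Lp ℂ 2 (massShell m)

/-- `(a, A)` sends `φ` to `p ↦ e^{i a·p} φ(Λ(A)⁻¹ p)`. -/
def scalarFun (g : PoincareCover) (φ : Spacetime → ℂ) (p : Spacetime) : ℂ :=
  Complex.exp (Complex.I * (mink g.left.toAdd p : ℝ)) * φ (lorentz g.right⁻¹ p)

theorem norm_scalarFun (g : PoincareCover) (φ : Spacetime → ℂ) (p : Spacetime) :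
    ‖scalarFun g φ p‖ = ‖φ (lorentz g.right⁻¹ p)‖ := by
  rw [scalarFun, norm_mul, mul_comm Complex.I, Complex.norm_exp_ofReal_mul_I, one_mul]

theorem scalarFun_one (φ : Spacetime → ℂ) : scalarFun 1 φ = φ := by
  funext p
  simp [scalarFun, mink]

theorem scalarFun_mul (g h : PoincareCover) (φ : Spacetime → ℂ) :
    scalarFun (g * h) φ = scalarFun g (scalarFun h φ) := by
  funext p
  have e : (g * h).left.toAdd = g.left.toAdd + lorentz g.right h.left.toAdd := rfl
  have e2 : mink (g * h).left.toAdd p =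
      mink g.left.toAdd p + mink h.left.toAdd (lorentz g.right⁻¹ p) := by
    rw [← mink_lorentz_left, e]
    simp only [mink, Pi.add_apply]; ring
  simp only [scalarFun, e2, SemidirectProduct.mul_right, _root_.mul_inv_rev, map_mul,
    LinearEquiv.mul_apply, ← mul_assoc, ← Complex.exp_add]
  congr 2
  push_cast
  ring

theorem scalarFun_congr (m : ℝ) (g : PoincareCover) {φ ψ : Spacetime → ℂ}
    (h : φ =ᵐ[massShell m] ψ) : scalarFun g φ =ᵐ[massShell m] scalarFun g ψ := by
  have := (measurePreserving_lorentz g.right⁻¹ m).quasiMeasurePreserving.ae_eq_comp h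
  filter_upwards [this] with p hp
  simp only [Function.comp] at hp
  simp only [scalarFun, hp]

theorem aestronglyMeasurable_scalarFun (m : ℝ) (g : PoincareCover) {φ : Spacetime → ℂ}
    (h : AEStronglyMeasurable φ (massShell m)) :
    AEStronglyMeasurable (scalarFun g φ) (massShell m) := by
  refine AEStronglyMeasurable.mul ?_
    (h.comp_measurePreserving (measurePreserving_lorentz g.right⁻¹ m))
  refine Continuous.aestronglyMeasurable ?_
  unfold mink
  fun_prop

theorem eLpNorm_scalarFun (m : ℝ) (g : PoincareCover) {φ : Spacetime → ℂ}
    (h : AEStronglyMeasurable φ (massShell m)) :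
    eLpNorm (scalarFun g φ) 2 (massShell m) = eLpNorm φ 2 (massShell m) := by
  rw [← eLpNorm_comp_measurePreserving h (measurePreserving_lorentz g.right⁻¹ m)]
  exact eLpNorm_congr_norm_ae (Filter.Eventually.of_forall fun p => norm_scalarFun g φ p)

theorem memLp_scalarFun (m : ℝ) (g : PoincareCover) (φ : ShellSpace m) :
    MemLp (scalarFun g φ) 2 (massShell m) := by
  refine ⟨aestronglyMeasurable_scalarFun m g (Lp.aestronglyMeasurable φ), ?_⟩
  rw [eLpNorm_scalarFun m g (Lp.aestronglyMeasurable φ)]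
  exact Lp.eLpNorm_lt_top φ

/-- The operator `U_{m,0}(g)` on `L²(Ω_m)`. -/
def scalarOp (m : ℝ) (g : PoincareCover) (φ : ShellSpace m) : ShellSpace m :=
  (memLp_scalarFun m g φ).toLp

theorem coeFn_scalarOp (m : ℝ) (g : PoincareCover) (φ : ShellSpace m) :
    scalarOp m g φ =ᵐ[massShell m] scalarFun g φ :=
  MemLp.coeFn_toLp _

theorem scalarOp_one (m : ℝ) (φ : ShellSpace m) : scalarOp m 1 φ = φ := by
  apply Lp.ext
  filter_upwards [coeFn_scalarOp m 1 φ] with p hp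
  rw [hp, scalarFun_one]

theorem scalarOp_mul (m : ℝ) (g h : PoincareCover) (φ : ShellSpace m) :
    scalarOp m (g * h) φ = scalarOp m g (scalarOp m h φ) := by
  apply Lp.ext
  filter_upwards [coeFn_scalarOp m (g * h) φ, coeFn_scalarOp m g (scalarOp m h φ),
    scalarFun_congr m g (coeFn_scalarOp m h φ)] with p h1 h2 h3
  rw [h1, h2, h3, scalarFun_mul]

/-- `U_{m,0}(g)` as a surjective linear isometry. -/
def scalarIso (m : ℝ) (g : PoincareCover) : ShellSpace m ≃ₗᵢ[ℂ] ShellSpace m where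
  toFun := scalarOp m g
  invFun := scalarOp m g⁻¹
  left_inv φ := by rw [← scalarOp_mul, inv_mul_cancel, scalarOp_one]
  right_inv φ := by rw [← scalarOp_mul, mul_inv_cancel, scalarOp_one]
  map_add' φ ψ := by
    apply Lp.ext
    filter_upwards [coeFn_scalarOp m g (φ + ψ), coeFn_scalarOp m g φ, coeFn_scalarOp m g ψ,
      Lp.coeFn_add (scalarOp m g φ) (scalarOp m g ψ),
      scalarFun_congr m g (Lp.coeFn_add φ ψ)] with p h1 h2 h3 h4 h5
    rw [h1, h5, h4, Pi.add_apply, h2, h3]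
    simp only [scalarFun, Pi.add_apply, mul_add]
  map_smul' c φ := by
    apply Lp.ext
    filter_upwards [coeFn_scalarOp m g (c • φ), coeFn_scalarOp m g φ,
      Lp.coeFn_smul c (scalarOp m g φ),
      scalarFun_congr m g (Lp.coeFn_smul c φ)] with p h1 h2 h4 h5
    rw [h1, h5, RingHom.id_apply, h4, Pi.smul_apply, h2]
    simp only [scalarFun, Pi.smul_apply, smul_eq_mul]
    ring
  norm_map' φ := by
    change ‖scalarOp m g φ‖ = ‖φ‖
    rw [scalarOp, Lp.norm_toLp, eLpNorm_scalarFun m g (Lp.aestronglyMeasurable φ), Lp.norm_def]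

/-- The scalar representation `U_{m,0}` of mass `m`:
`(U_{m,0}(a, A) φ)(p) = e^{i a·p} φ(Λ(A)⁻¹ p)` on `L²(Ω_m)`. -/
def scalarRep (m : ℝ) : PoincareCover →* unitary (ShellSpace m →L[ℂ] ShellSpace m) where
  toFun g := Unitary.linearIsometryEquiv.symm (scalarIso m g)
  map_one' := by
    rw [← map_one Unitary.linearIsometryEquiv.symm]
    congr 1
    ext1 φ
    exact scalarOp_one m φ
  map_mul' g h := by
    rw [← map_mul]
    congr 1
    ext1 φ
    exact scalarOp_mul m g h φ

theorem scalarRep_apply (m : ℝ) (g : PoincareCover) (φ : ShellSpace m) :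
    ((scalarRep m g : ShellSpace m →L[ℂ] ShellSpace m) φ : Spacetime → ℂ) =ᵐ[massShell m]
      fun p => Complex.exp (Complex.I * (mink g.left.toAdd p : ℝ)) * φ (lorentz g.right⁻¹ p) :=
  coeFn_scalarOp m g φ

/-- The wedge `W₁ = {x : |x₀| < x₁}`. -/
def wedge₁ : Set Spacetime := {x | |x 0| < x 1}

/-- The set `𝓦` of wedges: the images of `W₁` under the Poincaré group. -/
def wedges : Set (Set Spacetime) := {W | ∃ g : PoincareCover, W = act g '' wedge₁}

/-- The set `𝓦₀` of wedges that are images of `W₁` under Lorentz transformations. -/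
def wedges₀ : Set (Set Spacetime) := {W | ∃ A : SL2C, W = lorentz A '' wedge₁}

/-- The points that are spacelike to every point of `O`. -/
def spacelikeComplement (O : Set Spacetime) : Set Spacetime :=
  {x | ∀ y ∈ O, mink (x - y) (x - y) < 0}

/-- The causal complement `O'` of an open region, as an open region. For a wedge this is the
opposite open wedge: `W₁' = {x : |x₀| < -x₁}`. -/
def causalComplement (O : Set Spacetime) : Set Spacetime := interior (spacelikeComplement O)

/-- For `W ∈ 𝓦₀`, the group `G_W⁰` of all `A ∈ SL(2,ℂ)` with `Λ(A) W = W`. -/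
def lorentzStabilizer (W : Set Spacetime) : Subgroup SL2C where
  carrier := {A | lorentz A '' W = W}
  one_mem' := by
    change (fun x => lorentz 1 x) '' W = W
    simp
  mul_mem' {A B} hA hB := by
    have hA : lorentz A '' W = W := hA
    have hB : lorentz B '' W = W := hB
    change (fun x => lorentz (A * B) x) '' W = W
    simp only [map_mul, LinearEquiv.mul_apply]
    rw [← Set.image_image (lorentz A) (lorentz B) W, hB, hA]
  inv_mem' {A} hA := by
    have hA : lorentz A '' W = W := hA
    change (fun x => lorentz A⁻¹ x) '' W = W
    nth_rewrite 1 [← hA]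
    rw [Set.image_image]
    simp

/-- For `W ∈ 𝓦₀`, the group `G_W` generated by `G_W⁰` and the translations. -/
def wedgeGroup₀ (W : Set Spacetime) : Subgroup PoincareCover :=
  Subgroup.closure (SemidirectProduct.inr '' (lorentzStabilizer W : Set SL2C) ∪
    Set.range SemidirectProduct.inl)

/-- `G` is the group `G_W` of the wedge `W`: `G = g G_{W₀} g⁻¹` where `W = g W₀` with `W₀ ∈ 𝓦₀`
and `g` in the Poincaré group. (The group does not depend on the choice of `g` and `W₀`.) -/
def IsWedgeGroup (W : Set Spacetime) (G : Subgroup PoincareCover) : Prop :=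
  ∃ g : PoincareCover, ∃ W₀ ∈ wedges₀, W = act g '' W₀ ∧
    G = (wedgeGroup₀ W₀).map (MulAut.conj g).toMonoidHom

section Representations

variable {H : Type*} [NormedAddCommGroup H] [InnerProductSpace ℂ H] [CompleteSpace H]

/-- The von Neumann algebra `U(G)''`, as a set of bounded operators. -/
def bicommutant (U : PoincareCover →* unitary (H →L[ℂ] H)) (G : Subgroup PoincareCover) :
    Set (H →L[ℂ] H) :=
  Set.centralizer (Set.centralizer ((fun g => (U g : H →L[ℂ] H)) '' (G : Set PoincareCover)))

/-- The modularity condition: for every wedge `W` there are elements `r` of the covering group with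
`Λ(r) W = W'`, and `U(r) ∈ U(G_W)''` for each of them. -/
def ModularityCondition (U : PoincareCover →* unitary (H →L[ℂ] H)) : Prop :=
  ∀ W ∈ wedges, ∀ G, IsWedgeGroup W G →
    (∃ r : PoincareCover, act r '' W = causalComplement W) ∧
    ∀ r : PoincareCover, act r '' W = causalComplement W →
      (U r : H →L[ℂ] H) ∈ bicommutant U G

/-- A unitary representation is an irreducible scalar representation (massive of spin `0`, or
massless of helicity `0`) if it is unitarily equivalent to `U_{m,0}` for some mass `m ≥ 0`. -/
def IsIrreducibleScalar (U : PoincareCover →* unitary (H →L[ℂ] H)) : Prop :=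
  ∃ m : ℝ, 0 ≤ m ∧ ∃ V : H ≃ₗᵢ[ℂ] ShellSpace m,
    ∀ (g : PoincareCover) (ξ : H),
      V ((U g : H →L[ℂ] H) ξ) = (scalarRep m g : ShellSpace m →L[ℂ] ShellSpace m) (V ξ)

end Representations

end

end Poincare

/-!
After conjugation with a Poincaré transformation, and a unitary equivalence, the claim concerns the
wedge `W₁`, the representation `U_{m,0}`, and a bounded operator `T` that commutes with
`U_{m,0}(G_{W₁})`; it has to be shown that `T` commutes with `U_{m,0}(r)` for every `r` that maps
`W₁` to the opposite wedge.

Since `T` commutes with the translations, it is multiplication by a function `f` on the mass shell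
(`exists_eq_mul_of_commute_translations`); this rests on the injectivity of the Fourier transform
on `L¹`. Since `T` commutes with the boosts along the first axis and the rotations about it, `f` is
almost everywhere invariant under each of them. The rotation by `π` about the third axis, which maps
`W₁` to the opposite wedge, sends `(p₀, p₁, p₂, p₃)` to `(p₀, -p₁, -p₂, p₃)`, and for `|p₁| < p₀`
this point lies on the orbit of `p` under the boosts and rotations
(`exists_boostRot_eq_halfTurn`). The condition `|p₁| < p₀` fails only on a null set of the mass
shell, also for `m = 0`. Fubini's theorem on the product of the parameter plane and the mass shell
then gives the invariance of `f` under the half turn (`ae_eq_comp_halfTurn`), so `T` commutes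
with it. Any other `r` is the product of a translation, the inverse of the half turn, and a Lorentz
transformation preserving `W₁`, because both wedges are cones (`lorentz_right_image_wedge₁`).
-/

namespace Poincare

open MeasureTheory Matrix
open scoped ENNReal ComplexConjugate

/-! ### Operators commuting with the translations -/

/-- Injectivity of the Fourier transform on real `L¹` functions: positive and negative part are the
densities of two finite measures with the same characteristic function. -/
theorem ae_eq_zero_of_forall_integral_exp_mul_ofReal_eq_zero {E : Type*} [NormedAddCommGroup E]
    [NormedSpace ℝ E] [CompleteSpace E] [SecondCountableTopology E] [MeasurableSpace E]
    [BorelSpace E] {μ : Measure E} {h : E → ℝ} (hi : Integrable h μ)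
    (hz : ∀ L : StrongDual ℝ E, ∫ x, Complex.exp (L x * Complex.I) * (h x : ℂ) ∂μ = 0) :
    h =ᵐ[μ] 0 := by
  have hm : ∀ {g : E → ℝ}, Integrable g μ → AEMeasurable (fun x => ENNReal.ofReal (g x)) μ :=
    fun hg => hg.aestronglyMeasurable.aemeasurable.ennreal_ofReal
  have hchar : ∀ {g : E → ℝ}, Integrable g μ → ∀ L : StrongDual ℝ E,
      charFunDual (μ.withDensity fun x => ENNReal.ofReal (g x)) L =
        ∫ x, Complex.exp (L x * Complex.I) * ((max (g x) 0 : ℝ) : ℂ) ∂μ := by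
    intro g hg L
    rw [charFunDual_apply, integral_withDensity_eq_integral_toReal_smul₀ (hm hg)
      (Filter.Eventually.of_forall fun x => ENNReal.ofReal_lt_top)]
    refine integral_congr_ae (Filter.Eventually.of_forall fun x => ?_)
    simp only [ENNReal.toReal_ofReal', Complex.real_smul]
    ring
  have hint : ∀ {g : E → ℝ}, Integrable g μ → ∀ L : StrongDual ℝ E,
      Integrable (fun x => Complex.exp (L x * Complex.I) * ((max (g x) 0 : ℝ) : ℂ)) μ := by
    intro g hg L
    refine hg.pos_part.ofReal.bdd_mul (c := 1) ?_ (Filter.Eventually.of_forall fun x => ?_)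
    · exact Continuous.aestronglyMeasurable (by fun_prop)
    · rw [Complex.norm_exp_ofReal_mul_I]
  have := isFiniteMeasure_withDensity_ofReal hi.2
  have := isFiniteMeasure_withDensity_ofReal hi.neg.2
  have hν : μ.withDensity (fun x => ENNReal.ofReal (h x)) =
      μ.withDensity (fun x => ENNReal.ofReal ((-h) x)) := by
    refine Measure.ext_of_charFunDual (funext fun L => ?_)
    rw [hchar hi, hchar hi.neg, ← sub_eq_zero, ← integral_sub (hint hi L) (hint hi.neg L), ← hz L]
    refine integral_congr_ae (Filter.Eventually.of_forall fun x => ?_)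
    have : max (h x) 0 - max ((-h) x) 0 = h x := by
      simp only [Pi.neg_apply]
      rcases le_total (h x) 0 with h0 | h0
      · rw [max_eq_right h0, max_eq_left (by linarith)]; ring
      · rw [max_eq_left h0, max_eq_right (by linarith)]; ring
    simp only [← mul_sub, ← Complex.ofReal_sub, this]
  have hae := (withDensity_eq_iff (hm hi) (hm hi.neg)
    hi.lintegral_lt_top.ne).1 hν
  filter_upwards [hae] with x hx
  simp only [Pi.neg_apply] at hx
  rcases le_total (h x) 0 with h0 | h0
  · rw [ENNReal.ofReal_of_nonpos h0, eq_comm, ENNReal.ofReal_eq_zero] at hx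
    exact le_antisymm h0 (neg_nonpos.1 hx)
  · rw [ENNReal.ofReal_of_nonpos (p := -h x) (by linarith), ENNReal.ofReal_eq_zero] at hx
    exact le_antisymm hx h0

/-- Injectivity of the Fourier transform on `L¹`. -/
theorem ae_eq_zero_of_forall_integral_exp_mul_eq_zero {E : Type*} [NormedAddCommGroup E]
    [NormedSpace ℝ E] [CompleteSpace E] [SecondCountableTopology E] [MeasurableSpace E]
    [BorelSpace E] {μ : Measure E} {h : E → ℂ} (hi : Integrable h μ)
    (hz : ∀ L : StrongDual ℝ E, ∫ x, Complex.exp (L x * Complex.I) * h x ∂μ = 0) :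
    h =ᵐ[μ] 0 := by
  have hint : ∀ {g : E → ℂ}, Integrable g μ → ∀ L : StrongDual ℝ E,
      Integrable (fun x => Complex.exp (L x * Complex.I) * g x) μ := by
    intro g hg L
    refine hg.bdd_mul (c := 1) ?_ (Filter.Eventually.of_forall fun x => ?_)
    · exact Continuous.aestronglyMeasurable (by fun_prop)
    · rw [Complex.norm_exp_ofReal_mul_I]
  have hic : Integrable (fun x => conj (h x)) μ :=
    (integrable_norm_iff (Complex.continuous_conj.comp_aestronglyMeasurable
      hi.aestronglyMeasurable)).1 (by simpa using hi.norm)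
  have hzc : ∀ L : StrongDual ℝ E, ∫ x, Complex.exp (L x * Complex.I) * conj (h x) ∂μ = 0 := by
    intro L
    have := congrArg conj (hz (-L))
    rw [← integral_conj, map_zero] at this
    rw [← this]
    refine integral_congr_ae (Filter.Eventually.of_forall fun x => ?_)
    simp [← Complex.exp_conj]
  have hre := ae_eq_zero_of_forall_integral_exp_mul_ofReal_eq_zero hi.re fun L => by
    have : ∀ x, Complex.exp (L x * Complex.I) * ((RCLike.re (h x) : ℝ) : ℂ) =
        2⁻¹ * (Complex.exp (L x * Complex.I) * h x + Complex.exp (L x * Complex.I) * conj (h x)) := by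
      intro x
      have := Complex.re_eq_add_conj (h x)
      simp only [RCLike.re_to_complex, this]
      ring
    simp_rw [this]
    rw [integral_const_mul, integral_add (hint hi L) (hint hic L), hz, hzc]
    simp
  have him := ae_eq_zero_of_forall_integral_exp_mul_ofReal_eq_zero hi.im fun L => by
    have : ∀ x, Complex.exp (L x * Complex.I) * ((RCLike.im (h x) : ℝ) : ℂ) =
        (2 * Complex.I)⁻¹ *
          (Complex.exp (L x * Complex.I) * h x - Complex.exp (L x * Complex.I) * conj (h x)) := by
      intro x
      have := Complex.im_eq_sub_conj (h x)
      simp only [RCLike.im_to_complex, this]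
      field_simp
    simp_rw [this]
    rw [integral_const_mul, integral_sub (hint hi L) (hint hic L), hz, hzc]
    simp
  filter_upwards [hre, him] with x h1 h2
  exact Complex.ext h1 h2

/-- Every linear functional on spacetime is of the form `p ↦ (a, p)`. -/
theorem exists_mink_eq (L : StrongDual ℝ Spacetime) : ∃ a : Spacetime, ∀ p, mink a p = L p := by
  refine ⟨![L (Pi.single 0 1), -L (Pi.single 1 1), -L (Pi.single 2 1), -L (Pi.single 3 1)],
    fun p => ?_⟩
  have hp : p = ∑ i, p i • (Pi.single i 1 : Spacetime) := by
    ext j; simp [Finset.sum_apply, Pi.single_apply]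
  conv_rhs => rw [hp]
  simp only [Fin.sum_univ_four, mink]
  simp
  ring

/-- On a `σ`-finite measure space there is a strictly positive `L²` function. -/
theorem exists_pos_Lp_two {α : Type*} [MeasurableSpace α] (μ : Measure α) [SigmaFinite μ] :
    ∃ ψ : Lp ℂ 2 μ, ∃ w : α → ℝ, (∀ x, 0 < w x) ∧ Measurable w ∧ ψ =ᵐ[μ] fun x => (w x : ℂ) := by
  obtain ⟨g, hg0, hgm, hg1⟩ := exists_pos_lintegral_lt_of_sigmaFinite μ (ε := 1) (by simp)
  have hw : Measurable fun x => √(g x : ℝ) := by fun_prop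
  have hL : MemLp (fun x => ((√(g x : ℝ) : ℝ) : ℂ)) 2 μ := by
    rw [memLp_two_iff_integrable_sq_norm (by fun_prop)]
    have : (fun x => ‖((√(g x : ℝ) : ℝ) : ℂ)‖ ^ 2) = fun x => (g x : ℝ) := by
      funext x
      rw [Complex.norm_real, Real.norm_of_nonneg (Real.sqrt_nonneg _),
        Real.sq_sqrt (g x).coe_nonneg]
    rw [this]
    refine ⟨by fun_prop, ?_⟩
    rw [hasFiniteIntegral_iff_ofReal (Filter.Eventually.of_forall fun x => (g x).coe_nonneg)]
    simpa using hg1.trans ENNReal.one_lt_top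
  exact ⟨hL.toLp, fun x => √(g x : ℝ), fun x => Real.sqrt_pos.2 (NNReal.coe_pos.2 (hg0 x)), hw,
    hL.coeFn_toLp⟩

/-- The translations generate a maximal abelian algebra: an operator on `L²(Ω_m)` commuting with
them is a multiplication operator. -/
theorem exists_eq_mul_of_commute_translations {m : ℝ} {T : ShellSpace m →L[ℂ] ShellSpace m}
    (hT : ∀ a : Spacetime, Commute T
      (scalarRep m (SemidirectProduct.inl (Multiplicative.ofAdd a)) :
        ShellSpace m →L[ℂ] ShellSpace m)) :
    ∃ f : Spacetime → ℂ, Measurable f ∧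
      ∀ φ : ShellSpace m, T φ =ᵐ[massShell m] fun p => f p * φ p := by
  -- The `L¹` functions `conj ψ · Tφ` and `conj (T*ψ) · φ` have the same Fourier transform.
  have key : ∀ φ ψ : ShellSpace m,
      (fun p => conj (ψ p) * T φ p) =ᵐ[massShell m]
        fun p => conj ((ContinuousLinearMap.adjoint T) ψ p) * φ p := by
    intro φ ψ
    set S := ContinuousLinearMap.adjoint T with hS
    have h1 : Integrable (fun p => conj (ψ p) * T φ p) (massShell m) := by
      have := L2.integrable_inner (𝕜 := ℂ) ψ (T φ)
      simpa only [RCLike.inner_apply, mul_comm] using this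
    have h2 : Integrable (fun p => conj (S ψ p) * φ p) (massShell m) := by
      have := L2.integrable_inner (𝕜 := ℂ) (S ψ) φ
      simpa only [RCLike.inner_apply, mul_comm] using this
    have hz := ae_eq_zero_of_forall_integral_exp_mul_eq_zero (h1.sub h2) fun L => by
      obtain ⟨a, ha⟩ := exists_mink_eq L
      set u : PoincareCover := SemidirectProduct.inl (Multiplicative.ofAdd a) with hu
      have hUφ : ∀ χ : ShellSpace m,
          ((scalarRep m u : ShellSpace m →L[ℂ] ShellSpace m) χ : Spacetime → ℂ)
            =ᵐ[massShell m] fun p => Complex.exp (L p * Complex.I) * χ p := by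
        intro χ
        filter_upwards [scalarRep_apply m u χ] with p hp
        rw [hp]
        simp [hu, ha, mul_comm]
      have hc : inner ℂ ψ ((scalarRep m u : ShellSpace m →L[ℂ] ShellSpace m) (T φ)) =
          inner ℂ (S ψ) ((scalarRep m u : ShellSpace m →L[ℂ] ShellSpace m) φ) := by
        rw [hS, ContinuousLinearMap.adjoint_inner_left]
        exact congrArg (inner ℂ ψ) (DFunLike.congr_fun (hT a).eq φ).symm
      rw [L2.inner_def, L2.inner_def] at hc
      have hi : ∀ {g : Spacetime → ℂ}, Integrable g (massShell m) →
          Integrable (fun p => Complex.exp (L p * Complex.I) * g p) (massShell m) := by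
        intro g hg
        refine hg.bdd_mul (c := 1) ?_ (Filter.Eventually.of_forall fun x => ?_)
        · exact Continuous.aestronglyMeasurable (by fun_prop)
        · rw [Complex.norm_exp_ofReal_mul_I]
      simp only [Pi.sub_apply, mul_sub]
      rw [integral_sub (hi h1) (hi h2), sub_eq_zero]
      refine Eq.trans ?_ (hc.trans ?_)
      · refine integral_congr_ae ?_
        filter_upwards [hUφ (T φ)] with p hp
        rw [hp, RCLike.inner_apply]
        ring
      · refine integral_congr_ae ?_
        filter_upwards [hUφ φ] with p hp
        rw [hp, RCLike.inner_apply]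
        ring
    filter_upwards [hz] with p hp
    exact sub_eq_zero.1 hp
  obtain ⟨ψ, w, hw0, hwm, hψ⟩ := exists_pos_Lp_two (massShell m)
  set S := ContinuousLinearMap.adjoint T with hS
  have hSm := (Lp.aestronglyMeasurable (S ψ)).aemeasurable
  refine ⟨fun p => conj (hSm.mk _ p) / (w p : ℂ),
    (Complex.continuous_conj.measurable.comp hSm.measurable_mk).div
      (Complex.measurable_ofReal.comp hwm), fun φ => ?_⟩
  filter_upwards [key φ ψ, hψ, hSm.ae_eq_mk] with p hp h1 h2
  have hne : (w p : ℂ) ≠ 0 := Complex.ofReal_ne_zero.2 (hw0 p).ne'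
  rw [h1, h2, Complex.conj_ofReal] at hp
  rw [div_mul_eq_mul_div, ← hp, mul_div_cancel_left₀ _ hne]

/-- A multiplication operator commutes with a Lorentz transformation exactly if the function is
invariant under it. -/
theorem commute_scalarRep_inr_iff {m : ℝ} {T : ShellSpace m →L[ℂ] ShellSpace m}
    {f : Spacetime → ℂ} (hf : ∀ φ : ShellSpace m, T φ =ᵐ[massShell m] fun p => f p * φ p)
    (A : SL2C) :
    Commute T (scalarRep m (SemidirectProduct.inr A) : ShellSpace m →L[ℂ] ShellSpace m) ↔
      (fun p => f (lorentz A⁻¹ p)) =ᵐ[massShell m] f := by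
  set R : ShellSpace m →L[ℂ] ShellSpace m :=
    (scalarRep m (SemidirectProduct.inr A) : ShellSpace m →L[ℂ] ShellSpace m) with hR
  have hRφ : ∀ φ : ShellSpace m, R φ =ᵐ[massShell m] fun p => φ (lorentz A⁻¹ p) := by
    intro φ
    filter_upwards [scalarRep_apply m (SemidirectProduct.inr A) φ] with p hp
    rw [hR, hp]
    simp [mink]
  have hRT : ∀ φ : ShellSpace m,
      R (T φ) =ᵐ[massShell m] fun p => f (lorentz A⁻¹ p) * φ (lorentz A⁻¹ p) := by
    intro φ
    filter_upwards [hRφ (T φ),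
      (measurePreserving_lorentz A⁻¹ m).quasiMeasurePreserving.ae_eq_comp (hf φ)] with p h1 h2
    rw [h1]
    exact h2
  have hTR : ∀ φ : ShellSpace m,
      T (R φ) =ᵐ[massShell m] fun p => f p * φ (lorentz A⁻¹ p) := by
    intro φ
    filter_upwards [hf (R φ), hRφ φ] with p h1 h2
    rw [h1, h2]
  constructor
  · intro h
    obtain ⟨ψ, w, hw0, -, hψ⟩ := exists_pos_Lp_two (massShell m)
    have hc : T (R ψ) = R (T ψ) := DFunLike.congr_fun h.eq ψ
    filter_upwards [hTR ψ, hRT ψ,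
      (measurePreserving_lorentz A⁻¹ m).quasiMeasurePreserving.ae_eq_comp hψ] with p h1 h2 h3
    have h3 : ψ (lorentz A⁻¹ p) = (w (lorentz A⁻¹ p) : ℂ) := h3
    rw [hc, h2, h3] at h1
    exact mul_right_cancel₀ (Complex.ofReal_ne_zero.2 (hw0 _).ne') h1
  · intro h
    refine ContinuousLinearMap.ext fun φ => Lp.ext ?_
    filter_upwards [hTR φ, hRT φ, h] with p h1 h2 h3
    change T (R φ) p = R (T φ) p
    rw [h1, h2, h3]

/-! ### Boosts and rotations along the first axis -/

/-- `exp(z σ₁)`: the boost along the first axis of rapidity `2 Re z`, times the rotation about that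
axis by the angle `-2 Im z`. -/
noncomputable def boostRot (z : ℂ) : SL2C :=
  ⟨!![Complex.cosh z, Complex.sinh z; Complex.sinh z, Complex.cosh z], by
    rw [Matrix.det_fin_two_of]
    linear_combination Complex.cosh_sq_sub_sinh_sq z⟩

theorem boostRot_add (z w : ℂ) : boostRot (z + w) = boostRot z * boostRot w := by
  apply Subtype.ext
  change _ = (boostRot z).1 * (boostRot w).1
  ext i j
  fin_cases i <;> fin_cases j <;>
    simp [boostRot, Matrix.mul_apply, Fin.sum_univ_two, Complex.cosh_add, Complex.sinh_add] <;> ring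

theorem lorentz_boostRot_ofReal (t : ℝ) (p : Spacetime) :
    lorentz (boostRot t) p =
      ![Real.cosh (2 * t) * p 0 + Real.sinh (2 * t) * p 1,
        Real.sinh (2 * t) * p 0 + Real.cosh (2 * t) * p 1, p 2, p 3] := by
  change coords _ = _
  have h := Real.cosh_sq t
  rw [Real.cosh_two_mul, Real.sinh_two_mul]
  ext i
  fin_cases i <;>
    simp [coords, herm, boostRot, Matrix.mul_apply, Fin.sum_univ_two, ← Complex.ofReal_cosh,
      ← Complex.ofReal_sinh] <;> first
    | ring1
    | linear_combination p 2 * h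
    | linear_combination p 3 * h

theorem lorentz_boostRot_mul_I (θ : ℝ) (p : Spacetime) :
    lorentz (boostRot (θ * Complex.I)) p =
      ![p 0, p 1, Real.cos (2 * θ) * p 2 + Real.sin (2 * θ) * p 3,
        -Real.sin (2 * θ) * p 2 + Real.cos (2 * θ) * p 3] := by
  change coords _ = _
  have h := Real.cos_sq' θ
  rw [Real.cos_two_mul, Real.sin_two_mul]
  ext i
  fin_cases i <;>
    simp [coords, herm, boostRot, Matrix.mul_apply, Fin.sum_univ_two, ← Complex.ofReal_cos,
      ← Complex.ofReal_sin, Complex.cosh_mul_I, Complex.sinh_mul_I] <;>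
    first
    | linear_combination p 0 * h
    | linear_combination p 1 * h
    | linear_combination -p 2 * h
    | linear_combination -p 3 * h

theorem image_eq_of_mem_of_mem {α : Type*} {e f : α → α} {s : Set α} (hef : ∀ x, e (f x) = x)
    (he : ∀ x ∈ s, e x ∈ s) (hf : ∀ x ∈ s, f x ∈ s) : e '' s = s := by
  refine Set.Subset.antisymm (Set.image_subset_iff.2 he) fun x hx => ⟨f x, hf x hx, hef x⟩

theorem boostRot_zero : boostRot 0 = 1 := by
  apply Subtype.ext
  ext i j
  fin_cases i <;> fin_cases j <;> simp [boostRot]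

theorem lorentz_boostRot_mem_wedge₁ (z : ℂ) {x : Spacetime} (hx : x ∈ wedge₁) :
    lorentz (boostRot z) x ∈ wedge₁ := by
  have hx : |x 0| < x 1 := hx
  rw [← Complex.re_add_im z, boostRot_add, map_mul, LinearEquiv.mul_apply,
    lorentz_boostRot_ofReal, lorentz_boostRot_mul_I]
  change |(_ : ℝ)| < _
  simp only [Matrix.cons_val_zero, Matrix.cons_val_one]
  rw [abs_lt] at hx ⊢
  have h1 := Real.cosh_add_sinh (2 * z.re)
  have h2 := Real.cosh_sub_sinh (2 * z.re)
  have h3 := mul_pos (Real.exp_pos (2 * z.re)) (show 0 < x 0 + x 1 by linarith)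
  have h4 := mul_pos (Real.exp_pos (-(2 * z.re))) (show 0 < x 1 - x 0 by linarith)
  rw [← h1] at h3
  rw [← h2] at h4
  constructor <;> nlinarith

theorem boostRot_mem_lorentzStabilizer (z : ℂ) : boostRot z ∈ lorentzStabilizer wedge₁ := by
  refine image_eq_of_mem_of_mem (e := lorentz (boostRot z))
    (f := lorentz (boostRot (-z))) (fun x => ?_)
    (fun x => lorentz_boostRot_mem_wedge₁ z) (fun x => lorentz_boostRot_mem_wedge₁ (-z))
  rw [← LinearEquiv.mul_apply, ← map_mul lorentz, ← boostRot_add, add_neg_cancel, boostRot_zero,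
    map_one]
  rfl

theorem continuous_herm : Continuous herm := by
  refine continuous_matrix fun i j => ?_
  fin_cases i <;> fin_cases j <;> simp [herm] <;> fun_prop

theorem continuous_coords : Continuous coords := by
  have h : ∀ i j, Continuous fun M : Matrix (Fin 2) (Fin 2) ℂ => M i j := fun i j =>
    continuous_id.matrix_elem i j
  have hre := fun i j => Complex.continuous_re.comp (h i j)
  have him := fun i j => Complex.continuous_im.comp (h i j)
  refine continuous_pi fun i => ?_
  fin_cases i
  · exact ((hre 0 0).add (hre 1 1)).div_const 2
  · exact hre 1 0
  · exact him 1 0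
  · exact ((hre 0 0).sub (hre 1 1)).div_const 2

theorem continuous_lorentz_boostRot :
    Continuous fun x : ℂ × Spacetime => lorentz (boostRot x.1) x.2 := by
  have hM : Continuous fun x : ℂ × Spacetime => (boostRot x.1).1 := by
    refine continuous_matrix fun i j => ?_
    fin_cases i <;> fin_cases j
    · exact Complex.continuous_cosh.comp continuous_fst
    · exact Complex.continuous_sinh.comp continuous_fst
    · exact Complex.continuous_sinh.comp continuous_fst
    · exact Complex.continuous_cosh.comp continuous_fst
  exact continuous_coords.comp ((hM.matrix_mul (continuous_herm.comp continuous_snd)).matrix_mul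
    hM.matrix_conjTranspose)

/-- The rotation by `π` about the third axis; it maps `W₁` to the opposite wedge. -/
noncomputable def halfTurn : SL2C :=
  ⟨!![Complex.I, 0; 0, -Complex.I], by simp [Matrix.det_fin_two_of]⟩

theorem lorentz_halfTurn (p : Spacetime) : lorentz halfTurn p = ![p 0, -p 1, -p 2, p 3] := by
  change coords _ = _
  ext i
  fin_cases i <;>
    simp [coords, herm, halfTurn, Matrix.mul_apply, Fin.sum_univ_two]

theorem lorentz_halfTurn_halfTurn (p : Spacetime) :
    lorentz halfTurn (lorentz halfTurn p) = p := by
  ext i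
  fin_cases i <;> simp [lorentz_halfTurn]

/-- Where `|p₁| < p₀`, the half turn moves each point along its orbit under boosts and rotations:
`p₀² - p₁²` and `p₂² + p₃²` are the invariants of these orbits. -/
theorem exists_boostRot_eq_halfTurn {p : Spacetime} (hp : |p 1| < p 0) :
    ∃ z : ℂ, lorentz (boostRot z) p = lorentz halfTurn p := by
  rw [abs_lt] at hp
  -- The rapidity with `e^{2t} (p₀ + p₁) = p₀ - p₁`.
  obtain ⟨t, ht⟩ : ∃ t : ℝ, Real.exp (2 * t) * (p 0 + p 1) = p 0 - p 1 := by
    have h1 : 0 < p 0 + p 1 := by linarith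
    have h2 : 0 < p 0 - p 1 := by linarith
    refine ⟨Real.log ((p 0 - p 1) / (p 0 + p 1)) / 2, ?_⟩
    rw [mul_div_cancel₀ _ two_ne_zero, Real.exp_log (div_pos h2 h1), div_mul_cancel₀ _ h1.ne']
  have ht' : Real.exp (-(2 * t)) * (p 0 - p 1) = p 0 + p 1 := by
    rw [← ht, ← mul_assoc, ← Real.exp_add, neg_add_cancel, Real.exp_zero, one_mul]
  -- The reflection `p₂ + i p₃ ↦ -p₂ + i p₃` turns a vector of argument `α` by `π - 2α`.
  set α := Complex.arg ⟨p 2, p 3⟩ with hα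
  set ρ := ‖(⟨p 2, p 3⟩ : ℂ)‖ with hρ
  have h2 : p 2 = ρ * Real.cos α := (Complex.norm_mul_cos_arg ⟨p 2, p 3⟩).symm
  have h3 : p 3 = ρ * Real.sin α := (Complex.norm_mul_sin_arg ⟨p 2, p 3⟩).symm
  refine ⟨t + ((α - Real.pi / 2 : ℝ) : ℂ) * Complex.I, ?_⟩
  rw [boostRot_add, map_mul, LinearEquiv.mul_apply, lorentz_boostRot_ofReal,
    lorentz_boostRot_mul_I, lorentz_halfTurn]
  have e : 2 * (α - Real.pi / 2) = 2 * α - Real.pi := by ring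
  have hcs := Real.sin_sq_add_cos_sq α
  rw [← Real.cosh_add_sinh] at ht
  rw [← Real.cosh_sub_sinh] at ht'
  ext i
  fin_cases i
  · simp; linarith
  · simp; linarith
  · simp only [e, Real.cos_sub_pi, Real.sin_sub_pi, Real.cos_two_mul, Real.sin_two_mul]
    simp
    rw [h2, h3]
    linear_combination (-2 * ρ * Real.cos α) * hcs
  · simp only [e, Real.cos_sub_pi, Real.sin_sub_pi, Real.cos_two_mul, Real.sin_two_mul]
    simp
    rw [h2, h3]
    ring

/-- On the mass shell, only massless momenta along the first axis violate `|p₁| < p₀`. -/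
theorem ae_abs_lt_massShell (m : ℝ) : ∀ᵐ p ∂massShell m, |p 1| < p 0 := by
  have hs : MeasurableSet {p : Spacetime | |p 1| < p 0} :=
    (isOpen_lt (by fun_prop) (by fun_prop)).measurableSet
  rw [massShell, ae_map_iff (continuous_shellPoint m).measurable.aemeasurable hs]
  refine (withDensity_absolutelyContinuous _ _).ae_le ?_
  -- The plane `q₁ = 0` is a null set; elsewhere `q₀² < q² ≤ q² + m²`.
  have h1 : ∀ᵐ q : Fin 3 → ℝ, q 1 ≠ 0 := by
    have := (Measure.quasiMeasurePreserving_eval (fun _ : Fin 3 => (volume : Measure ℝ)) 1).ae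
      (p := fun x => x ≠ 0) (by rw [ae_iff]; simp)
    exact this
  filter_upwards [h1] with q hq
  change |q 0| < energy m q
  rw [energy, Real.lt_sqrt (abs_nonneg _), sq_abs]
  have : 0 < q 1 ^ 2 := by positivity
  nlinarith [sq_nonneg (q 2), sq_nonneg m]

/-- A function on the mass shell that is almost invariant under every boost and rotation along the
first axis is almost invariant under the half turn. The half turn of a point is its image under a
boost and a rotation that depend on the point, so Fubini's theorem and the translation invariance of
Lebesgue measure on the parameters are needed to combine null sets. -/
theorem ae_eq_comp_halfTurn {m : ℝ} {f : Spacetime → ℂ} (hf : Measurable f)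
    (hinv : ∀ z : ℂ, (fun p => f (lorentz (boostRot z) p)) =ᵐ[massShell m] f) :
    (fun p => f (lorentz halfTurn p)) =ᵐ[massShell m] f := by
  have hmeas : MeasurableSet {x : ℂ × Spacetime | f (lorentz (boostRot x.1) x.2) = f x.2} :=
    measurableSet_eq_fun (hf.comp continuous_lorentz_boostRot.measurable) (hf.comp measurable_snd)
  have h1 : ∀ᵐ p ∂massShell m, ∀ᵐ z : ℂ, f (lorentz (boostRot z) p) = f p :=
    (Measure.ae_ae_comm hmeas).1 (Filter.Eventually.of_forall hinv)
  have h2 := (measurePreserving_lorentz halfTurn m).quasiMeasurePreserving.ae h1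
  filter_upwards [h1, h2, ae_abs_lt_massShell m] with p hp1 hp2 hp3
  obtain ⟨w, hw⟩ := exists_boostRot_eq_halfTurn hp3
  have hp1' := (measurePreserving_add_right (volume : Measure ℂ) w).quasiMeasurePreserving.ae hp1
  obtain ⟨z, hz1, hz2⟩ := (hp1'.and hp2).exists
  rw [← hz2, ← hz1, ← hw, boostRot_add, map_mul, LinearEquiv.mul_apply]

/-! ### Causal complements of wedges -/

theorem mem_spacelikeComplement_wedge₁ {x : Spacetime} :
    x ∈ spacelikeComplement wedge₁ ↔ |x 0| ≤ -x 1 := by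
  constructor
  · intro h
    by_contra hx
    rw [abs_le, not_and_or, not_le, not_le] at hx
    -- A point of `W₁` at lightlike separation from `x`, in the plane `x + ℝe₀ + ℝe₁`.
    have aux : ∀ ε : ℝ, ε * ε = 1 → 0 < x 1 + ε * x 0 → False := by
      intro ε hε hpos
      set s : ℝ := |x 0| + |x 1| + 1 with hs
      have h0 := abs_le.1 (le_refl |x 0|)
      have h1 := abs_le.1 (le_refl |x 1|)
      have hy : (![x 0 - ε * s, x 1 + s, x 2, x 3] : Spacetime) ∈ wedge₁ := by
        change |x 0 - ε * s| < x 1 + s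
        rcases mul_self_eq_one_iff.1 hε with rfl | rfl <;> rw [abs_lt] <;>
          constructor <;> linarith [h0.1, h0.2, h1.1, h1.2]
      have := h _ hy
      simp [mink] at this
      nlinarith
    rcases hx with hx | hx
    · exact aux (-1) (by norm_num) (by linarith)
    · exact aux 1 (by norm_num) (by linarith)
  · intro hx y hy
    have hy : |y 0| < y 1 := hy
    rw [abs_le] at hx
    rw [abs_lt] at hy
    simp only [mink, Pi.sub_apply]
    have : (x 0 - y 0) * (x 0 - y 0) < (x 1 - y 1) * (x 1 - y 1) := by
      nlinarith
    nlinarith [sq_nonneg (x 2 - y 2), sq_nonneg (x 3 - y 3)]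

theorem mem_causalComplement_wedge₁ {x : Spacetime} :
    x ∈ causalComplement wedge₁ ↔ |x 0| < -x 1 := by
  constructor
  · intro h
    -- Points of the interior stay in the complement when moved a little in the direction `e₁`.
    have hc : Continuous fun t : ℝ => x + t • (Pi.single 1 1 : Spacetime) := by fun_prop
    have hn : ∀ᶠ t in nhds (0 : ℝ), x + t • (Pi.single 1 1 : Spacetime) ∈
        spacelikeComplement wedge₁ := by
      refine hc.continuousAt.eventually ?_
      simpa using mem_interior_iff_mem_nhds.1 h
    obtain ⟨ε, hε, hball⟩ := Metric.eventually_nhds_iff.1 hn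
    have := mem_spacelikeComplement_wedge₁.1 (hball (y := ε / 2) (by
      rw [dist_zero_right, Real.norm_of_nonneg (by linarith)]; linarith))
    simp at this
    linarith
  · intro hx
    refine mem_interior.2 ⟨{x | |x 0| < -x 1}, fun y hy => ?_,
      isOpen_lt (by fun_prop) (by fun_prop), hx⟩
    exact mem_spacelikeComplement_wedge₁.2 (le_of_lt hy)

/-- The action of a Poincaré transformation as a homeomorphism of spacetime. -/
noncomputable def actHomeomorph (g : PoincareCover) : Spacetime ≃ₜ Spacetime where
  toFun := act g
  invFun := act g⁻¹
  left_inv x := by rw [← act_mul, inv_mul_cancel, act_one]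
  right_inv x := by rw [← act_mul, mul_inv_cancel, act_one]
  continuous_toFun := (continuous_lorentz _).add continuous_const
  continuous_invFun := (continuous_lorentz _).add continuous_const

theorem act_image_mul (g h : PoincareCover) (O : Set Spacetime) :
    act (g * h) '' O = act g '' (act h '' O) := by
  rw [Set.image_image]
  simp only [act_mul]

theorem act_image_one (O : Set Spacetime) : act 1 '' O = O := by
  simp [act_one]

theorem mink_act_sub (g : PoincareCover) (x y : Spacetime) :
    mink (act g x - act g y) (act g x - act g y) = mink (x - y) (x - y) := by
  rw [act, act, add_sub_add_right_eq_sub, ← map_sub, mink_lorentz_self]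

theorem spacelikeComplement_act_image (g : PoincareCover) (O : Set Spacetime) :
    spacelikeComplement (act g '' O) = act g '' spacelikeComplement O := by
  ext x
  obtain ⟨x, rfl⟩ := (actHomeomorph g).surjective x
  have hinj : Function.Injective (act g) := (actHomeomorph g).injective
  change act g x ∈ _ ↔ act g x ∈ _
  rw [hinj.mem_set_image]
  simp only [spacelikeComplement, Set.mem_ofPred_eq, Set.forall_mem_image, mink_act_sub]

theorem causalComplement_act_image (g : PoincareCover) (O : Set Spacetime) :
    causalComplement (act g '' O) = act g '' causalComplement O := by
  rw [causalComplement, spacelikeComplement_act_image]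
  exact ((actHomeomorph g).image_interior _).symm

/-- A cone that is a translate of a cone is equal to it. -/
theorem eq_of_image_add_eq {C D : Set Spacetime} {a : Spacetime}
    (hC : ∀ c : ℝ, 0 < c → ∀ x ∈ C, c • x ∈ C) (hD : ∀ c : ℝ, 0 < c → ∀ x ∈ D, c • x ∈ D)
    (h : (fun x => x + a) '' C = D) : C = D := by
  have h1 : ∀ x, x ∈ C ↔ x + a ∈ D := by
    intro x
    rw [← h]
    exact ((add_left_injective a).mem_set_image).symm
  -- Scaling by `2` shows that `C + 2a = D` as well.
  have h2 : ∀ x, x ∈ C ↔ x + a + a ∈ D := by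
    intro x
    constructor
    · intro hx
      have := hD 2 two_pos _ ((h1 _).1 (hC (1 / 2) (by norm_num) x hx))
      convert this using 1
      module
    · intro hx
      have := hC 2 two_pos _ ((h1 ((1 / 2 : ℝ) • x)).2 (by
        convert hD (1 / 2) (by norm_num) _ hx using 1
        module))
      convert this using 1
      module
  ext x
  have h3 := h1 (x - a)
  rw [h2 (x - a), sub_add_cancel] at h3
  rw [h1 x, h3]

theorem lorentz_halfTurn_image_wedge₁ : lorentz halfTurn '' wedge₁ = causalComplement wedge₁ := by
  ext x
  rw [mem_causalComplement_wedge₁]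
  constructor
  · rintro ⟨y, hy, rfl⟩
    have hy : |y 0| < y 1 := hy
    simpa [lorentz_halfTurn] using hy
  · intro hx
    refine ⟨lorentz halfTurn x, ?_, lorentz_halfTurn_halfTurn x⟩
    change |(_ : ℝ)| < _
    simpa [lorentz_halfTurn] using hx

theorem act_inr_image (A : SL2C) (O : Set Spacetime) :
    act (SemidirectProduct.inr A) '' O = lorentz A '' O :=
  Set.image_congr fun x _ => add_zero (lorentz A x)

/-- The Lorentz part of a Poincaré transformation mapping `W₁` to the opposite wedge does so
itself, since both wedges are cones. -/
theorem lorentz_right_image_wedge₁ {r : PoincareCover}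
    (hr : act r '' wedge₁ = causalComplement wedge₁) :
    lorentz r.right '' wedge₁ = causalComplement wedge₁ := by
  refine eq_of_image_add_eq (a := r.left.toAdd) ?_ ?_ ?_
  · rintro c hc - ⟨x, hx, rfl⟩
    refine ⟨c • x, ?_, map_smul _ _ _⟩
    have hx : |x 0| < x 1 := hx
    change |c * x 0| < c * x 1
    rw [abs_mul, abs_of_pos hc]
    exact mul_lt_mul_of_pos_left hx hc
  · intro c hc x hx
    rw [mem_causalComplement_wedge₁] at hx ⊢
    simp only [Pi.smul_apply, smul_eq_mul]
    rw [abs_mul, abs_of_pos hc, ← mul_neg]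
    exact mul_lt_mul_of_pos_left hx hc
  · rw [Set.image_image]
    exact hr

/-! ### The modularity condition -/

/-- The modularity condition for the wedge `W₁` and the representation `U_{m,0}`. -/
theorem commute_scalarRep_of_image_wedge₁ {m : ℝ} {T : ShellSpace m →L[ℂ] ShellSpace m}
    (hT : ∀ g ∈ wedgeGroup₀ wedge₁, Commute T (scalarRep m g : ShellSpace m →L[ℂ] ShellSpace m))
    {r : PoincareCover} (hr : act r '' wedge₁ = causalComplement wedge₁) :
    Commute T (scalarRep m r : ShellSpace m →L[ℂ] ShellSpace m) := by
  have hinl : ∀ a, (SemidirectProduct.inl a : PoincareCover) ∈ wedgeGroup₀ wedge₁ := fun a =>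
    Subgroup.subset_closure (Or.inr ⟨a, rfl⟩)
  have hinr : ∀ A ∈ lorentzStabilizer wedge₁,
      (SemidirectProduct.inr A : PoincareCover) ∈ wedgeGroup₀ wedge₁ := fun A hA =>
    Subgroup.subset_closure (Or.inl ⟨A, hA, rfl⟩)
  obtain ⟨f, hfm, hf⟩ := exists_eq_mul_of_commute_translations fun a => hT _ (hinl _)
  -- `T` commutes with the half turn because the inverse of a boost or rotation is one as well.
  have hhalf : Commute T
      (scalarRep m (SemidirectProduct.inr halfTurn⁻¹) : ShellSpace m →L[ℂ] ShellSpace m) := by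
    rw [commute_scalarRep_inr_iff hf, inv_inv]
    refine ae_eq_comp_halfTurn hfm fun z => ?_
    have := (commute_scalarRep_inr_iff hf (boostRot z)⁻¹).1
      (hT _ (hinr _ (inv_mem (boostRot_mem_lorentzStabilizer z))))
    rwa [inv_inv] at this
  have hmem : halfTurn * r.right ∈ lorentzStabilizer wedge₁ := by
    change (fun x => lorentz (halfTurn * r.right) x) '' wedge₁ = wedge₁
    simp only [map_mul, LinearEquiv.mul_apply]
    rw [← Set.image_image (lorentz halfTurn) (lorentz r.right) wedge₁,
      lorentz_right_image_wedge₁ hr, ← lorentz_halfTurn_image_wedge₁, Set.image_image]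
    simp only [lorentz_halfTurn_halfTurn, Set.image_id']
  have hdec : r = SemidirectProduct.inl r.left * SemidirectProduct.inr halfTurn⁻¹ *
      SemidirectProduct.inr (halfTurn * r.right) := by
    rw [mul_assoc, ← map_mul, inv_mul_cancel_left, SemidirectProduct.inl_left_mul_inr_right]
  rw [hdec, map_mul, map_mul]
  exact ((hT _ (hinl _)).mul_right hhalf).mul_right (hT _ (hinr _ hmem))

/-- Commutation is preserved by a linear equivalence `K` that intertwines `X` and `Y`. -/
theorem commute_conj_iff {𝕜 E F : Type*} [NontriviallyNormedField 𝕜] [NormedAddCommGroup E]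
    [NormedSpace 𝕜 E] [NormedAddCommGroup F] [NormedSpace 𝕜 F] (K : E ≃L[𝕜] F)
    {T X : E →L[𝕜] E} {Y : F →L[𝕜] F} (hK : ∀ ξ, K (X ξ) = Y (K ξ)) :
    Commute ((K : E →L[𝕜] F) ∘L T ∘L (K.symm : F →L[𝕜] E)) Y ↔ Commute T X := by
  have hK' : ∀ η, K.symm (Y η) = X (K.symm η) := fun η => by
    rw [K.symm_apply_eq, hK, K.apply_symm_apply]
  constructor
  · intro h
    refine ContinuousLinearMap.ext fun ξ => K.injective ?_
    have := DFunLike.congr_fun h.eq (K ξ)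
    simpa [hK', hK] using this
  · intro h
    refine ContinuousLinearMap.ext fun η => ?_
    have := DFunLike.congr_fun h.eq (K.symm η)
    change T (X (K.symm η)) = X (T (K.symm η)) at this
    simp [hK', ← hK, this]

theorem conj_inr_mem_wedgeGroup₀ {B A : SL2C} (hA : A ∈ lorentzStabilizer wedge₁) :
    (SemidirectProduct.inr (B * A * B⁻¹) : PoincareCover) ∈
      wedgeGroup₀ (lorentz B '' wedge₁) := by
  refine Subgroup.subset_closure (Or.inl ⟨_, ?_, rfl⟩)
  change (fun x => lorentz (B * A * B⁻¹) x) '' (lorentz B '' wedge₁) = _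
  have hA : lorentz A '' wedge₁ = wedge₁ := hA
  conv_rhs => rw [← hA]
  rw [Set.image_image, Set.image_image]
  simp only [map_mul, LinearEquiv.mul_apply, lorentz_inv_apply]

/-- The group of the wedge `Λ(B) W₁` contains the conjugate by `B` of the group of `W₁`. -/
theorem map_conj_wedgeGroup₀_le (B : SL2C) :
    (wedgeGroup₀ wedge₁).map (MulAut.conj (SemidirectProduct.inr B : PoincareCover)).toMonoidHom ≤
      wedgeGroup₀ (lorentz B '' wedge₁) := by
  rw [Subgroup.map_le_iff_le_comap, wedgeGroup₀, Subgroup.closure_le]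
  rintro _ (⟨A, hA, rfl⟩ | ⟨a, rfl⟩)
  · have := conj_inr_mem_wedgeGroup₀ (B := B) hA
    rwa [map_mul, map_mul, map_inv] at this
  · refine Subgroup.subset_closure (Or.inr ⟨lorentzAut B a, ?_⟩)
    change _ = SemidirectProduct.inr B * SemidirectProduct.inl a * (SemidirectProduct.inr B)⁻¹
    rw [SemidirectProduct.inl_aut, map_inv]

end Poincare

theorem proposition4p3 {H : Type*} [NormedAddCommGroup H] [InnerProductSpace ℂ H]
    [CompleteSpace H] (U : Poincare.PoincareCover →* unitary (H →L[ℂ] H))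
    (hU : Poincare.IsIrreducibleScalar U) :
    Poincare.ModularityCondition U := by
  open Poincare in
  obtain ⟨m, -, V, hV⟩ := hU
  rintro W - G ⟨g, W₀, ⟨B, rfl⟩, rfl, rfl⟩
  set h : PoincareCover := g * SemidirectProduct.inr B with hh
  have hW : act g '' (lorentz B '' wedge₁) = act h '' wedge₁ := by
    rw [hh, act_image_mul, act_inr_image]
  have hG : ∀ k ∈ wedgeGroup₀ wedge₁,
      h * k * h⁻¹ ∈ (wedgeGroup₀ (lorentz B '' wedge₁)).map (MulAut.conj g).toMonoidHom := by
    intro k hk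
    refine ⟨_, map_conj_wedgeGroup₀_le B ⟨k, hk, rfl⟩, ?_⟩
    simp [hh, mul_assoc]
  rw [hW, causalComplement_act_image]
  constructor
  · refine ⟨h * SemidirectProduct.inr halfTurn * h⁻¹, ?_⟩
    rw [← act_image_mul, inv_mul_cancel_right, act_image_mul, act_inr_image,
      lorentz_halfTurn_image_wedge₁]
  · intro r hr
    -- `r = h k h⁻¹`, where `k` maps `W₁` to the opposite wedge.
    obtain ⟨k, rfl⟩ : ∃ k, r = h * k * h⁻¹ := ⟨h⁻¹ * r * h, by group⟩
    have hk : act k '' wedge₁ = causalComplement wedge₁ := by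
      refine (actHomeomorph h).injective.image_injective ?_
      rw [← act_image_mul, inv_mul_cancel_right, act_image_mul] at hr
      exact hr
    -- `K` intertwines `k ↦ U(h k h⁻¹)` with `U_{m,0}`.
    set K : H ≃L[ℂ] ShellSpace m :=
      ((Unitary.linearIsometryEquiv (U h⁻¹)).trans V).toContinuousLinearEquiv
    have hK : ∀ (k : PoincareCover) (ξ : H), K ((U (h * k * h⁻¹) : H →L[ℂ] H) ξ) =
        (scalarRep m k : ShellSpace m →L[ℂ] ShellSpace m) (K ξ) := by
      intro k ξ
      have e : ∀ η, K η = V ((U h⁻¹ : H →L[ℂ] H) η) := fun η => rfl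
      have hmul : U h⁻¹ * U (h * k * h⁻¹) = U k * U h⁻¹ := by
        rw [← map_mul, ← map_mul, mul_assoc h, inv_mul_cancel_left]
      rw [e, e, ← hV]
      exact congrArg V (DFunLike.congr_fun (congrArg Subtype.val hmul) ξ)
    refine Set.mem_centralizer_iff.2 fun T hT => ?_
    have hT' : ∀ k ∈ wedgeGroup₀ wedge₁, Commute T (U (h * k * h⁻¹) : H →L[ℂ] H) := fun k hk =>
      (Set.mem_centralizer_iff.1 hT _ ⟨_, hG k hk, rfl⟩).symm
    exact (commute_conj_iff K (hK k)).1 (commute_scalarRep_of_image_wedge₁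
      (fun k hk => (commute_conj_iff K (hK k)).2 (hT' k hk)) hk)
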